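/- Let $d\ge 1$ be an integer and $u\in\mathbb C\setminus\{0\}$. For $n\ge 0$ let $\mathrm Y_{d,n}(u)$ be the Yokonuma--Hecke algebra: the unital associative $\mathbb C$-algebra generated by $g_1,\dots,g_{n-1},t_1,\dots,t_n$ with relations $g_ig_j=g_jg_i$ for $|i-j|>1$, $g_ig_{i+1}g_i=g_{i+1}g_ig_{i+1}$, $t_it_j=t_jt_i$, $t_jg_i=g_it_{s_i(j)}$ (where $s_i$ is the transposition $(i,i+1)$), $t_j^d=1$, and $g_i^2=1+(u-1)e_i+(u-1)e_ig_i$, where $e_i=\frac1d\sum_{s=0}^{d-1}t_i^st_{i+1}^{d-s}$. (For $n=0$ it is $\mathbb C$.) Let $\iota_n:\mathrm Y_{d,n}(u)\to\mathrm Y_{d,n+1}(u)$ be the homomorphism that sends each generator to the generator of the same name. Let $z\in\mathbb C$ and let $x:\mathbb Z/d\mathbb Z\to\mathbb C$, $m\mapsto x_m$, with $x_0=1$. The Juyumaya trace with parameters $z,x_1,\dots,x_{d-1}$ is the unique family of linear maps $\mathrm{tr}=\mathrm{tr}_n:\mathrm Y_{d,n}(u)\to\mathbb C$ (such a family exists and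 is unique) with $\mathrm{tr}_{n+1}\circ\iota_n=\mathrm{tr}_n$, $\mathrm{tr}(1)=1$, $\mathrm{tr}(ab)=\mathrm{tr}(ba)$ for $a,b\in \mathrm Y_{d,n}(u)$, $\mathrm{tr}(\iota_n(a)\,g_n)=z\,\mathrm{tr}(a)$ for $n\ge1$, $a\in \mathrm Y_{d,n}(u)$, and $\mathrm{tr}(\iota_n(a)\,t_{n+1}^m)=x_m\,\mathrm{tr}(a)$ for $a\in \mathrm Y_{d,n}(u)$, $1\le m\le d-1$. For $n\ge 3$ let $\mathrm{FTL}_{d,n}(u)$ be the quotient of $\mathrm Y_{d,n}(u)$ by the two-sided ideal generated by the elements $e_ie_{i+1}g_{i,i+1}$, $1\le i\le n-2$, where $g_{i,i+1}=g_ig_{i+1}g_i+g_{i+1}g_i+g_ig_{i+1}+g_i+g_{i+1}+1$. The trace passes to $\mathrm{FTL}_{d,n}(u)$ if $\mathrm{tr}_n$ factors through the quotient map. Write $\exp(j)=e^{2\pi i j/d}$ for $j\in\mathbb Z/d\mathbb Z$, let $y_k=\sum_{m\in\mathbb Z/d\mathbb Z}x_m\exp(-km)$ be the values of the Fourier transform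 $\widehat x$ of $x$, and let $$D_1=\{k\in\operatorname{supp}\widehat x : y_k=-dz\},\qquad D_2=\{k\in\operatorname{supp}\widehat x : y_k=-dz(u+1)\}.$$ **Theorem.** For every $n\ge3$, the trace $\mathrm{tr}$ passes to $\mathrm{FTL}_{d,n}(u)$ if and only if $$x_m=-z\Bigl(\sum_{k\in D_1}\exp(km)+(u+1)\sum_{k\in D_2}\exp(km)\Bigr)\quad\text{for all } m\in\mathbb Z/d\mathbb Z$$ and $$|D_1|+(u+1)|D_2|\neq0,\qquad z=-\frac{1}{|D_1|+(u+1)|D_2|}.$$ Moreover, in this case $D_1$ and $D_2$ are disjoint and $D_1\cup D_2$ is the support of $\widehat x$. -/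

import Mathlib

noncomputable section

/-- Generators of the Yokonuma-Hecke algebra on `n` strands, with indices starting at `0`:
the braiding generators `g i` for `0 ≤ i < n - 1` (the strands `i` and `i + 1`) and the framing
generators `t j` for `0 ≤ j < n`. -/
inductive YHGen (n : ℕ) : Type
  | g (i : ℕ) (hi : i + 1 < n) : YHGen n
  | t (j : ℕ) (hj : j < n) : YHGen n

/-- The expression `(1/d) ∑_{s=0}^{d-1} a^s b^(d-s)` in a complex algebra. With `a = t_i` and
`b = t_{i+1}` this is the element `e_i`. -/
def yhE {A : Type*} [Ring A] [Algebra ℂ A] (d : ℕ) (a b : A) : A :=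
  (1 / (d : ℂ)) • ∑ s ∈ Finset.range d, a ^ s * b ^ (d - s)

theorem yh_swap_lt {n i j : ℕ} (hi : i + 1 < n) (hj : j < n) :
    Equiv.swap i (i + 1) j < n := by
  rw [Equiv.swap_apply_def]
  split_ifs <;> omega

namespace YHGen

/-- The braiding generator as an element of the free algebra. -/
def G {n : ℕ} (i : ℕ) (hi : i + 1 < n) : FreeAlgebra ℂ (YHGen n) :=
  FreeAlgebra.ι ℂ (YHGen.g i hi)

/-- The framing generator as an element of the free algebra. -/
def T {n : ℕ} (j : ℕ) (hj : j < n) : FreeAlgebra ℂ (YHGen n) :=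
  FreeAlgebra.ι ℂ (YHGen.t j hj)

end YHGen

open YHGen in
/-- The defining relations of the Yokonuma-Hecke algebra. -/
inductive YHRel (d : ℕ) (u : ℂ) (n : ℕ) :
    FreeAlgebra ℂ (YHGen n) → FreeAlgebra ℂ (YHGen n) → Prop
  | far (i j : ℕ) (hi : i + 1 < n) (hj : j + 1 < n) (hij : i + 1 < j ∨ j + 1 < i) :
      YHRel d u n (G i hi * G j hj) (G j hj * G i hi)
  | braid (i : ℕ) (hi : i + 2 < n) :
      YHRel d u n
        (G i (by omega) * G (i + 1) hi * G i (by omega))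
        (G (i + 1) hi * G i (by omega) * G (i + 1) hi)
  | frame_comm (i j : ℕ) (hi : i < n) (hj : j < n) :
      YHRel d u n (T i hi * T j hj) (T j hj * T i hi)
  | frame_braid (i j : ℕ) (hi : i + 1 < n) (hj : j < n) :
      YHRel d u n (T j hj * G i hi) (G i hi * T (Equiv.swap i (i + 1) j) (yh_swap_lt hi hj))
  | frame_pow (j : ℕ) (hj : j < n) :
      YHRel d u n (T j hj ^ d) 1
  | quadratic (i : ℕ) (hi : i + 1 < n) :
      YHRel d u n (G i hi ^ 2)
        (1 + (u - 1) • yhE d (T i (by omega)) (T (i + 1) hi)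
          + (u - 1) • (yhE d (T i (by omega)) (T (i + 1) hi) * G i hi))

/-- The Yokonuma-Hecke algebra `Y_{d,n}(u)`: the complex unital associative algebra with the
generators `YHGen n` and the relations `YHRel d u n`. -/
abbrev YH (d : ℕ) (u : ℂ) (n : ℕ) : Type := RingQuot (YHRel d u n)

namespace YH

variable (d : ℕ) (u : ℂ)

/-- The braiding generator `g_i` of `Y_{d,n}(u)`. -/
def g {n : ℕ} (i : ℕ) (hi : i + 1 < n) : YH d u n :=
  RingQuot.mkAlgHom ℂ (YHRel d u n) (YHGen.G i hi)

/-- The framing generator `t_j` of `Y_{d,n}(u)`. -/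
def t {n : ℕ} (j : ℕ) (hj : j < n) : YH d u n :=
  RingQuot.mkAlgHom ℂ (YHRel d u n) (YHGen.T j hj)

/-- The element `e_i` of `Y_{d,n}(u)`. -/
def e {n : ℕ} (i : ℕ) (hi : i + 1 < n) : YH d u n :=
  yhE d (t d u i (by omega)) (t d u (i + 1) hi)

theorem map_yhE {A B : Type*} [Ring A] [Algebra ℂ A] [Ring B] [Algebra ℂ B]
    (f : A →ₐ[ℂ] B) (a b : A) : f (yhE d a b) = yhE d (f a) (f b) := by
  simp [yhE]

variable {d u} in
theorem rel {n : ℕ} {a b : FreeAlgebra ℂ (YHGen n)} (h : YHRel d u n a b) :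
    RingQuot.mkAlgHom ℂ (YHRel d u n) a = RingQuot.mkAlgHom ℂ (YHRel d u n) b :=
  RingQuot.mkAlgHom_rel ℂ h

/-- The image of a generator on `n` strands among the elements of `Y_{d,n+1}(u)`. -/
def inclGen {n : ℕ} : YHGen n → YH d u (n + 1)
  | YHGen.g i hi => g d u i (by omega)
  | YHGen.t j hj => t d u j (by omega)

theorem inclGen_rel {n : ℕ} {a b : FreeAlgebra ℂ (YHGen n)} (h : YHRel d u n a b) :
    FreeAlgebra.lift ℂ (inclGen d u) a = FreeAlgebra.lift ℂ (inclGen d u) b := by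
  induction h with
  | far i j hi hj hij =>
    simpa [YHGen.G, inclGen, g] using
      rel (YHRel.far (d := d) (u := u) (n := n + 1) i j (by omega) (by omega) hij)
  | braid i hi =>
    simpa [YHGen.G, inclGen, g] using
      rel (YHRel.braid (d := d) (u := u) (n := n + 1) i (by omega))
  | frame_comm i j hi hj =>
    simpa [YHGen.T, inclGen, t] using
      rel (YHRel.frame_comm (d := d) (u := u) (n := n + 1) i j (by omega) (by omega))
  | frame_braid i j hi hj =>
    simpa [YHGen.T, YHGen.G, inclGen, t, g] using
      rel (YHRel.frame_braid (d := d) (u := u) (n := n + 1) i j (by omega) (by omega))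
  | frame_pow j hj =>
    simpa [YHGen.T, inclGen, t] using
      rel (YHRel.frame_pow (d := d) (u := u) (n := n + 1) j (by omega))
  | quadratic i hi =>
    simpa [YHGen.T, YHGen.G, inclGen, t, g, map_yhE] using
      rel (YHRel.quadratic (d := d) (u := u) (n := n + 1) i (by omega))

/-- The natural algebra homomorphism `Y_{d,n}(u) → Y_{d,n+1}(u)`, which sends each generator to
the generator with the same name. -/
def incl (n : ℕ) : YH d u n →ₐ[ℂ] YH d u (n + 1) :=
  RingQuot.liftAlgHom ℂ
    ⟨FreeAlgebra.lift ℂ (inclGen d u), fun _ _ h => inclGen_rel d u h⟩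

theorem incl_g {n : ℕ} (i : ℕ) (hi : i + 1 < n) :
    incl d u n (g d u i hi) = g d u i (by omega) := by
  simp [incl, g, YHGen.G, inclGen]

theorem incl_t {n : ℕ} (j : ℕ) (hj : j < n) :
    incl d u n (t d u j hj) = t d u j (by omega) := by
  simp [incl, t, YHGen.T, inclGen]

/-- The element `g_{i,i+1} = g_i g_{i+1} g_i + g_{i+1} g_i + g_i g_{i+1} + g_i + g_{i+1} + 1`. -/
def gg {n : ℕ} (i : ℕ) (hi : i + 2 < n) : YH d u n :=
  g d u i (by omega) * g d u (i + 1) hi * g d u i (by omega)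
    + g d u (i + 1) hi * g d u i (by omega)
    + g d u i (by omega) * g d u (i + 1) hi
    + g d u i (by omega) + g d u (i + 1) hi + 1

/-- The element `r_{i,i+1} = e_i e_{i+1} g_{i,i+1}`. -/
def r {n : ℕ} (i : ℕ) (hi : i + 2 < n) : YH d u n :=
  e d u i (by omega) * e d u (i + 1) hi * gg d u i hi

end YH

/-- The two-sided ideal of `Y_{d,n}(u)` generated by all the elements `r_{i,i+1}`. -/
def ftlIdeal (d : ℕ) (u : ℂ) (n : ℕ) : TwoSidedIdeal (YH d u n) :=
  TwoSidedIdeal.span {a | ∃ (i : ℕ) (hi : i + 2 < n), a = YH.r d u i hi}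

/-- The framization `FTL_{d,n}(u)` of the Temperley-Lieb algebra. -/
abbrev FTL (d : ℕ) (u : ℂ) (n : ℕ) : Type := (ftlIdeal d u n).ringCon.Quotient

/-- A linear functional on `Y_{d,n}(u)` passes to `FTL_{d,n}(u)` if it factors through the
quotient map. -/
def PassesToFTL {d : ℕ} {u : ℂ} {n : ℕ} (τ : YH d u n →ₗ[ℂ] ℂ) : Prop :=
  ∃ σ : FTL d u n →ₗ[ℂ] ℂ, ∀ a : YH d u n, σ ((ftlIdeal d u n).ringCon.mkₐ ℂ a) = τ a

/-- The defining rules of the Juyumaya trace with parameters `z` and `x_1, …, x_{d-1}`. A linear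
map on the inductive limit of the algebras `Y_{d,n}(u)` is given as a family of linear maps that is
compatible with the maps `Y_{d,n}(u) → Y_{d,n+1}(u)`. Because the indices start at `0`, the last
braiding generator of `Y_{d,n+2}(u)` is `g n` and the last framing generator of `Y_{d,n+1}(u)` is
`t n`. -/
structure IsJuyumayaTrace (d : ℕ) (u z : ℂ) (x : ZMod d → ℂ)
    (tr : ∀ n : ℕ, YH d u n →ₗ[ℂ] ℂ) : Prop where
  compat : ∀ (n : ℕ) (a : YH d u n), tr (n + 1) (YH.incl d u n a) = tr n a
  one : ∀ n : ℕ, tr n 1 = 1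
  comm : ∀ (n : ℕ) (a b : YH d u n), tr n (a * b) = tr n (b * a)
  markov : ∀ (n : ℕ) (a : YH d u (n + 1)),
    tr (n + 2) (YH.incl d u (n + 1) a * YH.g d u n (by omega)) = z * tr (n + 1) a
  frame : ∀ (n : ℕ) (a : YH d u n) (m : ℕ), 1 ≤ m → m ≤ d - 1 →
    tr (n + 1) (YH.incl d u n a * YH.t d u n (by omega) ^ m) = x (m : ZMod d) * tr n a

section Fourier

variable {d : ℕ} [NeZero d]

/-- The support of the Fourier transform `y_k = ∑_m x_m exp(-km)`, with
`exp(j) = e^{2πij/d}`, of a function on `ℤ/dℤ`. -/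
def ftSupport (x : ZMod d → ℂ) : Finset (ZMod d) :=
  {k | ZMod.dft x k ≠ 0}

open Classical in
/-- The set of those `k` in the support where `y_k = -dz`. -/
def ftD₁ (z : ℂ) (x : ZMod d → ℂ) : Finset (ZMod d) :=
  {k ∈ ftSupport x | ZMod.dft x k = -(d : ℂ) * z}

open Classical in
/-- The set of those `k` in the support where `y_k = -dz(u+1)`. -/
def ftD₂ (u z : ℂ) (x : ZMod d → ℂ) : Finset (ZMod d) :=
  {k ∈ ftSupport x | ZMod.dft x k = -(d : ℂ) * z * (u + 1)}

end Fourier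

end

/-!
Let `E_k(t_j)` be the projection to the `exp(k)`-eigenspace of `t_j`, and `w_k = y_k / d`, the
value prescribed for the trace of `E_k(t_j)`. As a bimodule over `ι(Y_{d,n})`, the algebra
`Y_{d,n+1}` is spanned by the `E_k(t_n)`, which commute with `ι(Y_{d,n})`, and `g_{n-1}`; hence
the trace is unique. For existence, each `k` gives a representation of `Y_{d,n+1}` on `n + 1`
copies of `Y_{d,n}`, induced from the character `t_n ↦ exp(k)`. Matrix coefficients of these
representations add up to a bimodule map `E : Y_{d,n+1} → Y_{d,n}` with `E_k(t_n) ↦ w_k` and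
`g_{n-1} ↦ z`, and the trace is the composite of such maps. Its symmetry follows by induction on
`n`; the hard case, `tr(a g_n) = tr(g_n a)`, reduces to the self-adjointness of
`a ↦ E(g_n ι(a) g_n)` with respect to the trace.

Since `u ≠ 0`, the `g_i` are invertible, so the elements `r_{i,i+1} = e_i e_{i+1} g_{i,i+1}` are
conjugate to each other. Now `e_0 e_1 = ∑_k E_k(t_0) E_k(t_1) E_k(t_2)`, and each
`E_k(t_0) E_k(t_1) E_k(t_2) g_{0,1}` spans a left ideal of dimension at most one in `Y_{d,3}`. So
the trace passes to the quotient if and only if it vanishes on these elements, where its value is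
`w_k (w_k + z) (w_k + (u + 1) z)`. This says that each `w_k` is `0`, `-z` or `-(u + 1) z`; Fourier
inversion turns it into the formula for `x_m`, and `m = 0` with `x_0 = 1` determines `z`.
-/

section Idempotents

variable {d : ℕ} {A : Type*} [Ring A] [Algebra ℂ A]

theorem pow_val_natCast {M : Type*} [Monoid M] {a : M} (ha : a ^ d = 1) (s : ℕ) :
    a ^ (s : ZMod d).val = a ^ s := by
  rw [ZMod.val_natCast]
  exact (pow_eq_pow_mod _ ha).symm

theorem semiconjBy_yhE {a a' b b' c : A} (ha : SemiconjBy c a a') (hb : SemiconjBy c b b') :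
    SemiconjBy c (yhE d a b) (yhE d a' b') := by
  simp only [SemiconjBy, yhE, mul_smul_comm, smul_mul_assoc, Finset.mul_sum, Finset.sum_mul,
    ((ha.pow_right _).mul_right (hb.pow_right _)).eq]

variable [NeZero d]

theorem pow_val_add {M : Type*} [Monoid M] {a : M} (ha : a ^ d = 1) (m l : ZMod d) :
    a ^ (m + l).val = a ^ m.val * a ^ l.val := by
  rw [ZMod.val_add, ← pow_add]
  exact (pow_eq_pow_mod _ ha).symm

theorem sum_range_natCast {M : Type*} [AddCommMonoid M] (f : ZMod d → M) :
    ∑ s ∈ Finset.range d, f (s : ZMod d) = ∑ m : ZMod d, f m := by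
  refine Finset.sum_bij' (fun s _ => (s : ZMod d)) (fun m _ => m.val) ?_ ?_ ?_ ?_ ?_
  · intros; simp
  · intro m _; simpa using ZMod.val_lt m
  · intro s hs; simpa using ZMod.val_cast_of_lt (by simpa using hs)
  · intro m _; simp
  · intros; rfl

theorem sum_stdAddChar_mul (b : ZMod d) :
    ∑ m : ZMod d, (ZMod.stdAddChar (m * b) : ℂ) = if b = 0 then (d : ℂ) else 0 := by
  rw [AddChar.sum_mulShift b (ZMod.isPrimitive_stdAddChar d)]
  split_ifs <;> simp [ZMod.card]

theorem stdAddChar_mul_natCast (k : ZMod d) (s : ℕ) :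
    (ZMod.stdAddChar (k * (s : ZMod d)) : ℂ) = ZMod.stdAddChar k ^ s := by
  rw [← AddChar.map_nsmul_eq_pow, nsmul_eq_mul, mul_comm]

theorem stdAddChar_pow_card (k : ZMod d) : (ZMod.stdAddChar k : ℂ) ^ d = 1 := by
  rw [← stdAddChar_mul_natCast]; simp

/-- For `a ^ d = 1`, the idempotent that projects to the eigenspace of `a` for the eigenvalue
`exp(k)`. -/
noncomputable def eigenIdem (k : ZMod d) (a : A) : A :=
  (1 / (d : ℂ)) • ∑ m : ZMod d, (ZMod.stdAddChar (-(m * k)) : ℂ) • a ^ m.val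

theorem map_eigenIdem {B : Type*} [Ring B] [Algebra ℂ B] (f : A →ₐ[ℂ] B) (k : ZMod d) (a : A) :
    f (eigenIdem k a) = eigenIdem k (f a) := by
  simp [eigenIdem]

theorem semiconjBy_eigenIdem {a b c : A} (h : SemiconjBy c a b) (k : ZMod d) :
    SemiconjBy c (eigenIdem k a) (eigenIdem k b) := by
  simp only [SemiconjBy, eigenIdem, mul_smul_comm, Finset.mul_sum, smul_mul_assoc, Finset.sum_mul,
    (h.pow_right _).eq]

theorem commute_eigenIdem {a b : A} (h : Commute a b) (k l : ZMod d) :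
    Commute (eigenIdem k a) (eigenIdem l b) :=
  semiconjBy_eigenIdem (semiconjBy_eigenIdem h.symm k).symm l

theorem mul_eigenIdem {a : A} (ha : a ^ d = 1) (k : ZMod d) :
    a * eigenIdem k a = (ZMod.stdAddChar k : ℂ) • eigenIdem k a := by
  simp only [eigenIdem, mul_smul_comm, Finset.mul_sum]
  rw [smul_comm]
  congr 1
  rw [Finset.smul_sum]
  refine Fintype.sum_equiv (Equiv.addRight 1) _ _ fun m => ?_
  simp only [Equiv.coe_addRight]
  rw [pow_val_add ha, smul_smul, ← AddChar.map_add_eq_mul]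
  have pow_val_one : a ^ (1 : ZMod d).val = a := by simpa using pow_val_natCast ha 1
  rw [pow_val_one, ← pow_succ, pow_succ']
  congr 2
  ring

theorem pow_mul_eigenIdem {a : A} (ha : a ^ d = 1) (k : ZMod d) (s : ℕ) :
    a ^ s * eigenIdem k a = (ZMod.stdAddChar (k * (s : ZMod d)) : ℂ) • eigenIdem k a := by
  induction s with
  | zero => simp
  | succ s ih =>
    rw [pow_succ', mul_assoc, ih, mul_smul_comm, mul_eigenIdem ha, smul_smul,
      ← AddChar.map_add_eq_mul]
    congr 2
    push_cast; ring

theorem eigenIdem_mul_eigenIdem {a : A} (ha : a ^ d = 1) (k l : ZMod d) :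
    eigenIdem k a * eigenIdem l a = if k = l then eigenIdem k a else 0 := by
  have mul_eq_smul : eigenIdem k a * eigenIdem l a
      = ((1 / (d : ℂ)) * ∑ m : ZMod d, (ZMod.stdAddChar (m * (l - k)) : ℂ)) • eigenIdem l a := by
    conv_lhs => rw [eigenIdem]
    rw [smul_mul_assoc, Finset.sum_mul, mul_smul, Finset.sum_smul]
    congr 1
    refine Finset.sum_congr rfl fun m _ => ?_
    rw [smul_mul_assoc, pow_mul_eigenIdem ha, smul_smul, ← AddChar.map_add_eq_mul]
    congr 2
    simp; ring
  rw [mul_eq_smul, sum_stdAddChar_mul]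
  have hd := NeZero.ne (d : ℂ)
  by_cases h : k = l
  · subst h; simp [hd]
  · simp [h, sub_ne_zero.mpr (Ne.symm h)]

theorem eigenIdem_mul_self {a : A} (ha : a ^ d = 1) (k : ZMod d) :
    eigenIdem k a * eigenIdem k a = eigenIdem k a := by
  simp [eigenIdem_mul_eigenIdem ha]

theorem sum_eigenIdem {a : A} : ∑ k : ZMod d, eigenIdem k a = 1 := by
  have hd := NeZero.ne (d : ℂ)
  simp only [eigenIdem]
  rw [← Finset.smul_sum, Finset.sum_comm]
  have inner_sum : ∀ m : ZMod d, ∑ k : ZMod d, (ZMod.stdAddChar (-(m * k)) : ℂ) • a ^ m.val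
      = if m = 0 then (d : ℂ) • (1 : A) else 0 := by
    intro m
    rw [← Finset.sum_smul]
    have sum_char := sum_stdAddChar_mul (-m)
    simp only [mul_neg, mul_comm _ m] at sum_char
    rw [sum_char]
    by_cases h : m = 0 <;> simp [h]
  simp [inner_sum, smul_smul, hd]

theorem pow_eq_sum_eigenIdem {a : A} (ha : a ^ d = 1) (s : ℕ) :
    a ^ s = ∑ k : ZMod d, (ZMod.stdAddChar (k * (s : ZMod d)) : ℂ) • eigenIdem k a := by
  conv_lhs => rw [← mul_one (a ^ s), ← sum_eigenIdem (d := d) (a := a), Finset.mul_sum]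
  simp only [pow_mul_eigenIdem ha]

theorem yhE_eq_sum {a b : A} (ha : a ^ d = 1) (hb : b ^ d = 1) :
    yhE d a b = ∑ k : ZMod d, eigenIdem k a * eigenIdem k b := by
  have hd := NeZero.ne (d : ℂ)
  have term_eq : ∀ s ∈ Finset.range d, a ^ s * b ^ (d - s)
      = ∑ k : ZMod d, ∑ l : ZMod d,
        (ZMod.stdAddChar ((s : ZMod d) * (k - l)) : ℂ) • (eigenIdem k a * eigenIdem l b) := by
    intro s hs
    rw [pow_eq_sum_eigenIdem ha, pow_eq_sum_eigenIdem hb, Finset.sum_mul_sum]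
    refine Finset.sum_congr rfl fun k _ => Finset.sum_congr rfl fun l _ => ?_
    rw [smul_mul_smul_comm, ← AddChar.map_add_eq_mul, Nat.cast_sub (Finset.mem_range.mp hs).le]
    congr 2
    simp; ring
  rw [yhE, Finset.sum_congr rfl term_eq,
    sum_range_natCast (fun s : ZMod d => ∑ k : ZMod d, ∑ l : ZMod d,
        (ZMod.stdAddChar (s * (k - l)) : ℂ) • (eigenIdem k a * eigenIdem l b)),
    Finset.sum_comm, Finset.smul_sum]
  refine Finset.sum_congr rfl fun k _ => ?_
  rw [Finset.sum_comm]
  simp only [← Finset.sum_smul, sum_stdAddChar_mul, sub_eq_zero]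
  simp [smul_smul, hd]

theorem eigenIdem_mul_yhE {a b : A} (ha : a ^ d = 1) (hb : b ^ d = 1) (k : ZMod d) :
    eigenIdem k a * yhE d a b = eigenIdem k a * eigenIdem k b := by
  rw [yhE_eq_sum ha hb, Finset.mul_sum]
  simp [← mul_assoc, eigenIdem_mul_eigenIdem ha]

theorem eigenIdem_smul_one (k l : ZMod d) :
    eigenIdem k ((ZMod.stdAddChar l : ℂ) • (1 : A)) = if k = l then 1 else 0 := by
  have hd := NeZero.ne (d : ℂ)
  have term_eq : ∀ m : ZMod d, (ZMod.stdAddChar (-(m * k)) : ℂ) •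
      ((ZMod.stdAddChar l : ℂ) • (1 : A)) ^ m.val
      = (ZMod.stdAddChar (m * (l - k)) : ℂ) • (1 : A) := by
    intro m
    rw [smul_pow, one_pow, smul_smul, ← stdAddChar_mul_natCast, ← AddChar.map_add_eq_mul]
    congr 2
    simp; ring
  rw [eigenIdem, Finset.sum_congr rfl fun m _ => term_eq m, ← Finset.sum_smul, sum_stdAddChar_mul]
  by_cases h : k = l
  · subst h; simp [hd]
  · simp [h, sub_ne_zero.mpr (Ne.symm h)]

theorem smul_one_pow_card (k : ZMod d) :
    ((ZMod.stdAddChar k : ℂ) • (1 : A)) ^ d = 1 := by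
  rw [smul_pow, one_pow, stdAddChar_pow_card, one_smul]

theorem yhE_smul_one_left {b : A} (hb : b ^ d = 1) (k : ZMod d) :
    yhE d ((ZMod.stdAddChar k : ℂ) • (1 : A)) b = eigenIdem k b := by
  rw [yhE_eq_sum (smul_one_pow_card k) hb]
  simp [eigenIdem_smul_one]

theorem yhE_smul_one_right {b : A} (hb : b ^ d = 1) (k : ZMod d) :
    yhE d b ((ZMod.stdAddChar k : ℂ) • (1 : A)) = eigenIdem k b := by
  rw [yhE_eq_sum hb (smul_one_pow_card k)]
  simp [eigenIdem_smul_one]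

theorem yhE_one_one : yhE d (1 : A) 1 = 1 := by
  simp [yhE, ← Nat.cast_smul_eq_nsmul ℂ, smul_smul, NeZero.ne (d : ℂ)]

end Idempotents

section Generators

variable {d : ℕ} {u : ℂ} {n : ℕ}

namespace YH

/-- The framing generator `t_j`, extended by `1` to all indices `j`. -/
noncomputable def frame (d : ℕ) (u : ℂ) (n j : ℕ) : YH d u n :=
  if h : j < n then t d u j h else 1

/-- The braiding generator `g_i`, extended by `0` to all indices `i`. -/
noncomputable def braid (d : ℕ) (u : ℂ) (n i : ℕ) : YH d u n :=
  if h : i + 1 < n then g d u i h else 0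

/-- The element `e_i`, extended to all indices `i`. -/
noncomputable def tie (d : ℕ) (u : ℂ) (n i : ℕ) : YH d u n :=
  yhE d (frame d u n i) (frame d u n (i + 1))

theorem t_eq_frame {j : ℕ} (h : j < n) : t d u j h = frame d u n j := by simp [frame, h]

theorem g_eq_braid {i : ℕ} (h : i + 1 < n) : g d u i h = braid d u n i := by simp [braid, h]

theorem e_eq_tie {i : ℕ} (h : i + 1 < n) : e d u i h = tie d u n i := by
  rw [e, t_eq_frame, t_eq_frame, tie]

theorem braid_of_le {i : ℕ} (h : n ≤ i + 1) : braid d u n i = 0 := by simp [braid, h]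

theorem frame_pow_card (j : ℕ) : frame d u n j ^ d = 1 := by
  by_cases h : j < n
  · simpa [frame, h, t] using rel (YHRel.frame_pow (d := d) (u := u) j h)
  · simp [frame, h]

theorem commute_frame (i j : ℕ) : Commute (frame d u n i) (frame d u n j) := by
  by_cases hi : i < n
  · by_cases hj : j < n
    · simpa [Commute, SemiconjBy, frame, hi, hj, t] using
        rel (YHRel.frame_comm (d := d) (u := u) i j hi hj)
    · simp [frame, hj]
  · simp [frame, hi]

theorem commute_braid {i j : ℕ} (h : i + 1 < j ∨ j + 1 < i) :
    Commute (braid d u n i) (braid d u n j) := by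
  by_cases hi : i + 1 < n
  · by_cases hj : j + 1 < n
    · simpa [Commute, SemiconjBy, braid, hi, hj, g] using
        rel (YHRel.far (d := d) (u := u) i j hi hj h)
    · simp [braid, hj]
  · simp [braid, hi]

theorem braid_mul_braid_mul_braid (i : ℕ) :
    braid d u n i * braid d u n (i + 1) * braid d u n i
      = braid d u n (i + 1) * braid d u n i * braid d u n (i + 1) := by
  by_cases h : i + 2 < n
  · have hi : i + 1 < n := by omega
    simpa [braid, hi, h, g] using rel (YHRel.braid (d := d) (u := u) i h)
  · rw [braid_of_le (i := i + 1) (by omega)]; simp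

theorem frame_mul_braid (i j : ℕ) :
    frame d u n j * braid d u n i = braid d u n i * frame d u n (Equiv.swap i (i + 1) j) := by
  by_cases hi : i + 1 < n
  · by_cases hj : j < n
    · have hj' := yh_swap_lt hi hj
      simpa [braid, frame, hi, hj, hj', g, t] using
        rel (YHRel.frame_braid (d := d) (u := u) i j hi hj)
    · have swap_eq : Equiv.swap i (i + 1) j = j :=
        Equiv.swap_apply_of_ne_of_ne (by omega) (by omega)
      simp [frame, swap_eq, hj]
  · simp [braid, hi]

theorem frame_mul_braid_self (i : ℕ) :
    frame d u n i * braid d u n i = braid d u n i * frame d u n (i + 1) := by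
  simp [frame_mul_braid]

theorem frame_succ_mul_braid (i : ℕ) :
    frame d u n (i + 1) * braid d u n i = braid d u n i * frame d u n i := by
  simp [frame_mul_braid]

theorem commute_frame_braid {i j : ℕ} (h : j ≠ i) (h' : j ≠ i + 1) :
    Commute (frame d u n j) (braid d u n i) := by
  rw [Commute, SemiconjBy, frame_mul_braid, Equiv.swap_apply_of_ne_of_ne h h']

theorem braid_mul_self {i : ℕ} (h : i + 1 < n) :
    braid d u n i * braid d u n i
      = 1 + (u - 1) • tie d u n i + (u - 1) • (tie d u n i * braid d u n i) := by
  have hi : i < n := by omega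
  simpa [tie, braid, frame, h, hi, g, t, pow_two, map_yhE] using
    rel (YHRel.quadratic (d := d) (u := u) i h)

theorem induction {P : YH d u n → Prop} (hc : ∀ c : ℂ, P (algebraMap ℂ _ c))
    (hadd : ∀ a b, P a → P b → P (a + b)) (hmul : ∀ a b, P a → P b → P (a * b))
    (hg : ∀ i, i + 1 < n → P (braid d u n i)) (ht : ∀ j, j < n → P (frame d u n j))
    (a : YH d u n) : P a := by
  obtain ⟨b, rfl⟩ := RingQuot.mkAlgHom_surjective ℂ (YHRel d u n) a
  induction b using FreeAlgebra.induction with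
  | grade0 c => simpa using hc c
  | grade1 x =>
    cases x with
    | g i hi => exact (congrArg P (g_eq_braid hi)).mpr (hg i hi)
    | t j hj => exact (congrArg P (t_eq_frame hj)).mpr (ht j hj)
  | mul a b ha hb => simpa using hmul _ _ ha hb
  | add a b ha hb => simpa using hadd _ _ ha hb

theorem incl_braid {i : ℕ} (h : i + 1 < n) :
    incl d u n (braid d u n i) = braid d u (n + 1) i := by
  rw [← g_eq_braid h, incl_g, g_eq_braid]

theorem incl_frame {j : ℕ} (h : j < n) : incl d u n (frame d u n j) = frame d u (n + 1) j := by
  rw [← t_eq_frame h, incl_t, t_eq_frame]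

theorem incl_tie {i : ℕ} (h : i + 1 < n) : incl d u n (tie d u n i) = tie d u (n + 1) i := by
  rw [tie, map_yhE, incl_frame (by omega), incl_frame h, tie]

theorem commute_incl_frame (a : YH d u n) : Commute (incl d u n a) (frame d u (n + 1) n) := by
  induction a using induction with
  | hc c => simpa using Algebra.commute_algebraMap_left c _
  | hadd a b ha hb => simpa using ha.add_left hb
  | hmul a b ha hb => simpa using ha.mul_left hb
  | hg i hi => rw [incl_braid hi]; exact (commute_frame_braid (by omega) (by omega)).symm
  | ht j hj => rw [incl_frame hj]; exact commute_frame j n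

theorem commute_incl_incl_braid (a : YH d u n) :
    Commute (incl d u (n + 1) (incl d u n a)) (braid d u (n + 2) n) := by
  induction a using induction with
  | hc c => simpa using Algebra.commute_algebraMap_left c _
  | hadd a b ha hb => simpa using ha.add_left hb
  | hmul a b ha hb => simpa using ha.mul_left hb
  | hg i hi => rw [incl_braid hi, incl_braid (by omega)]; exact commute_braid (Or.inl (by omega))
  | ht j hj =>
    rw [incl_frame hj, incl_frame (by omega)]
    exact commute_frame_braid (by omega) (by omega)

theorem braid_mul_incl_mul_braid_mul_incl_mul_braid {m : ℕ} (b c : YH d u (m + 1)) :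
    braid d u (m + 3) (m + 1) * incl d u (m + 2)
        (incl d u (m + 1) b * braid d u (m + 2) m * incl d u (m + 1) c) * braid d u (m + 3) (m + 1)
      = incl d u (m + 2) (incl d u (m + 1) b * braid d u (m + 2) m) * braid d u (m + 3) (m + 1)
        * incl d u (m + 2) (braid d u (m + 2) m * incl d u (m + 1) c) := by
  simp only [map_mul, incl_braid (show m + 1 < m + 2 by omega)]
  have hb := (commute_incl_incl_braid b).eq
  have hc := (commute_incl_incl_braid c).eq
  set g := braid d u (m + 3) (m + 1)
  set h := braid d u (m + 3) m
  set b' := incl d u (m + 2) (incl d u (m + 1) b)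
  set c' := incl d u (m + 2) (incl d u (m + 1) c)
  calc g * (b' * h * c') * g = (g * b') * h * (c' * g) := by simp only [mul_assoc]
    _ = b' * (g * h * g) * c' := by rw [← hb, hc]; simp only [mul_assoc]
    _ = b' * h * g * (h * c') := by
      rw [← braid_mul_braid_mul_braid m]; simp only [mul_assoc, h, g]

variable [NeZero d]

/-- The idempotent `E_k(t_j)`, which projects to the eigenspace of `t_j` for the eigenvalue
`exp(k)`. -/
noncomputable def frameIdem (d : ℕ) [NeZero d] (u : ℂ) (n : ℕ) (k : ZMod d) (j : ℕ) : YH d u n :=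
  eigenIdem k (frame d u n j)

theorem frameIdem_mul_frameIdem (k l : ZMod d) (j : ℕ) :
    frameIdem d u n k j * frameIdem d u n l j = if k = l then frameIdem d u n k j else 0 :=
  eigenIdem_mul_eigenIdem (frame_pow_card j) k l

theorem frameIdem_mul_self (k : ZMod d) (j : ℕ) :
    frameIdem d u n k j * frameIdem d u n k j = frameIdem d u n k j :=
  eigenIdem_mul_self (frame_pow_card j) k

theorem sum_frameIdem (j : ℕ) : ∑ k : ZMod d, frameIdem d u n k j = 1 := sum_eigenIdem

theorem commute_frameIdem (k l : ZMod d) (i j : ℕ) :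
    Commute (frameIdem d u n k i) (frameIdem d u n l j) :=
  commute_eigenIdem (commute_frame i j) k l

theorem commute_frame_frameIdem (k : ZMod d) (i j : ℕ) :
    Commute (frame d u n j) (frameIdem d u n k i) :=
  semiconjBy_eigenIdem (commute_frame _ _) k

theorem frame_mul_frameIdem (k : ZMod d) (j : ℕ) :
    frame d u n j * frameIdem d u n k j = (ZMod.stdAddChar k : ℂ) • frameIdem d u n k j :=
  mul_eigenIdem (frame_pow_card j) k

theorem braid_mul_frameIdem (k : ZMod d) (i : ℕ) :
    braid d u n i * frameIdem d u n k i = frameIdem d u n k (i + 1) * braid d u n i :=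
  semiconjBy_eigenIdem (frame_succ_mul_braid i).symm k

theorem braid_mul_frameIdem_succ (k : ZMod d) (i : ℕ) :
    braid d u n i * frameIdem d u n k (i + 1) = frameIdem d u n k i * braid d u n i :=
  semiconjBy_eigenIdem (frame_mul_braid_self i).symm k

theorem commute_braid_frameIdem (k : ZMod d) {i j : ℕ} (h : j ≠ i) (h' : j ≠ i + 1) :
    Commute (braid d u n i) (frameIdem d u n k j) :=
  semiconjBy_eigenIdem (commute_frame_braid h h').symm k

theorem tie_eq_sum (i : ℕ) :
    tie d u n i = ∑ k : ZMod d, frameIdem d u n k i * frameIdem d u n k (i + 1) :=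
  yhE_eq_sum (frame_pow_card _) (frame_pow_card _)

theorem frameIdem_mul_tie (k : ZMod d) (i : ℕ) :
    frameIdem d u n k i * tie d u n i = frameIdem d u n k i * frameIdem d u n k (i + 1) :=
  eigenIdem_mul_yhE (frame_pow_card _) (frame_pow_card _) k

theorem tie_mul_frameIdem_succ (k : ZMod d) (i : ℕ) :
    tie d u n i * frameIdem d u n k (i + 1) = frameIdem d u n k i * frameIdem d u n k (i + 1) := by
  simp [tie_eq_sum, Finset.sum_mul, mul_assoc, frameIdem_mul_frameIdem]

theorem frameIdem_succ_mul_tie (k : ZMod d) (i : ℕ) :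
    frameIdem d u n k (i + 1) * tie d u n i = frameIdem d u n k i * frameIdem d u n k (i + 1) := by
  rw [← tie_mul_frameIdem_succ, tie_eq_sum]
  exact Commute.sum_right _ _ _ fun l _ =>
    (commute_frameIdem k l _ _).mul_right (commute_frameIdem k l _ _)

theorem commute_braid_frameIdem_mul_frameIdem_succ (k : ZMod d) (i : ℕ) :
    Commute (braid d u n i) (frameIdem d u n k i * frameIdem d u n k (i + 1)) := by
  rw [Commute, SemiconjBy, ← mul_assoc, braid_mul_frameIdem, mul_assoc, braid_mul_frameIdem_succ,
    ← mul_assoc, (commute_frameIdem _ _ _ _).eq]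

theorem commute_braid_tie (i : ℕ) : Commute (braid d u n i) (tie d u n i) := by
  rw [tie_eq_sum]
  exact Commute.sum_right _ _ _ fun k _ => commute_braid_frameIdem_mul_frameIdem_succ k i

theorem frameIdem_mul_frameIdem_succ_mul_tie (k : ZMod d) (i : ℕ) :
    frameIdem d u n k i * frameIdem d u n k (i + 1) * tie d u n i
      = frameIdem d u n k i * frameIdem d u n k (i + 1) := by
  rw [mul_assoc, frameIdem_succ_mul_tie, ← mul_assoc, frameIdem_mul_self]

theorem tie_mul_self (i : ℕ) : tie d u n i * tie d u n i = tie d u n i := by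
  nth_rw 1 [tie_eq_sum]
  rw [Finset.sum_mul]
  simp only [frameIdem_mul_frameIdem_succ_mul_tie]
  exact (tie_eq_sum i).symm

theorem frameIdem_succ_mul_braid_mul_braid_mul (k : ZMod d) {i : ℕ} (h : i + 1 < n) (x : YH d u n) :
    frameIdem d u n k (i + 1) * (braid d u n i * (braid d u n i * x))
      = frameIdem d u n k (i + 1) * x
        + (u - 1) • (frameIdem d u n k i * (frameIdem d u n k (i + 1) * x))
        + (u - 1) • (frameIdem d u n k i * (frameIdem d u n k (i + 1) * (braid d u n i * x))) := by
  rw [← mul_assoc (braid d u n i), braid_mul_self h]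
  simp only [mul_add, add_mul, one_mul, mul_smul_comm, smul_mul_assoc, ← mul_assoc,
    frameIdem_succ_mul_tie]

theorem braid_mul_frameIdem_mul_braid (k : ZMod d) {i : ℕ} (h : i + 1 < n) :
    braid d u n i * frameIdem d u n k i * braid d u n i
      = frameIdem d u n k (i + 1) + (u - 1) • (frameIdem d u n k i * frameIdem d u n k (i + 1))
        + (u - 1) • (frameIdem d u n k i * braid d u n i * frameIdem d u n k i) := by
  have tie_mul_braid : tie d u n i * braid d u n i * frameIdem d u n k (i + 1)
      = frameIdem d u n k i * braid d u n i * frameIdem d u n k i := by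
    rw [← (commute_braid_tie i).eq, mul_assoc, tie_mul_frameIdem_succ,
      (commute_frameIdem _ _ _ _).eq, ← mul_assoc, braid_mul_frameIdem_succ]
  have move_left : braid d u n i * frameIdem d u n k i * braid d u n i
      = braid d u n i * braid d u n i * frameIdem d u n k (i + 1) := by
    rw [mul_assoc, mul_assoc, braid_mul_frameIdem_succ]
  rw [move_left, braid_mul_self h, add_mul, add_mul, one_mul, smul_mul_assoc, smul_mul_assoc,
    tie_mul_braid, tie_mul_frameIdem_succ]

theorem incl_frameIdem (k : ZMod d) {j : ℕ} (h : j < n) :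
    incl d u n (frameIdem d u n k j) = frameIdem d u (n + 1) k j := by
  rw [frameIdem, map_eigenIdem, incl_frame h, frameIdem]

theorem commute_incl_frameIdem (a : YH d u n) (k : ZMod d) :
    Commute (incl d u n a) (frameIdem d u (n + 1) k n) :=
  semiconjBy_eigenIdem (commute_incl_frame a) k

/-- The additive span of the elements `ι(b) E_k(t_n)` and `ι(b) g_{n-1} ι(c)` of `Y_{d,n+1}(u)`.
It is all of `Y_{d,n+1}(u)`. -/
def bimoduleSpan (d : ℕ) [NeZero d] (u : ℂ) (n : ℕ) : AddSubmonoid (YH d u (n + 1)) :=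
  AddSubmonoid.closure
    ({x | ∃ b k, x = incl d u n b * frameIdem d u (n + 1) k n} ∪
      {x | ∃ m, m + 1 = n ∧ ∃ b c, x = incl d u n b * braid d u (n + 1) m * incl d u n c})

namespace bimoduleSpan

theorem incl_mul_frameIdem_mem (b : YH d u n) (k : ZMod d) :
    incl d u n b * frameIdem d u (n + 1) k n ∈ bimoduleSpan d u n :=
  AddSubmonoid.subset_closure (Or.inl ⟨b, k, rfl⟩)

theorem incl_mul_braid_mul_incl_mem {m : ℕ} (h : m + 1 = n) (b c : YH d u n) :
    incl d u n b * braid d u (n + 1) m * incl d u n c ∈ bimoduleSpan d u n :=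
  AddSubmonoid.subset_closure (Or.inr ⟨m, h, b, c, rfl⟩)

theorem incl_mul_mem (a : YH d u n) {p : YH d u (n + 1)} (hp : p ∈ bimoduleSpan d u n) :
    incl d u n a * p ∈ bimoduleSpan d u n := by
  induction hp using AddSubmonoid.closure_induction with
  | mem x hx =>
    rcases hx with ⟨b, k, rfl⟩ | ⟨m, h, b, c, rfl⟩
    · rw [← mul_assoc, ← map_mul]; exact incl_mul_frameIdem_mem _ _
    · rw [← mul_assoc, ← mul_assoc, ← map_mul]; exact incl_mul_braid_mul_incl_mem h _ _
  | zero => simp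
  | add x y _ _ hx hy => rw [mul_add]; exact add_mem hx hy

theorem mul_incl_mem (a : YH d u n) {p : YH d u (n + 1)} (hp : p ∈ bimoduleSpan d u n) :
    p * incl d u n a ∈ bimoduleSpan d u n := by
  induction hp using AddSubmonoid.closure_induction with
  | mem x hx =>
    rcases hx with ⟨b, k, rfl⟩ | ⟨m, h, b, c, rfl⟩
    · rw [mul_assoc, ← (commute_incl_frameIdem _ _).eq, ← mul_assoc, ← map_mul]
      exact incl_mul_frameIdem_mem _ _
    · rw [mul_assoc, ← map_mul]; exact incl_mul_braid_mul_incl_mem h _ _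
  | zero => simp
  | add x y _ _ hx hy => rw [add_mul]; exact add_mem hx hy

theorem smul_mem (c : ℂ) {p : YH d u (n + 1)} (hp : p ∈ bimoduleSpan d u n) :
    c • p ∈ bimoduleSpan d u n := by
  have algebraMap_mul_mem := incl_mul_mem (algebraMap ℂ _ c) hp
  rwa [AlgHom.commutes, ← Algebra.smul_def] at algebraMap_mul_mem

theorem frameIdem_mem (k : ZMod d) : frameIdem d u (n + 1) k n ∈ bimoduleSpan d u n := by
  simpa using incl_mul_frameIdem_mem (n := n) (u := u) 1 k

theorem one_mem : 1 ∈ bimoduleSpan d u n := by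
  rw [← sum_frameIdem (d := d) n]
  exact sum_mem fun k _ => frameIdem_mem k

theorem frame_mul_mem {p : YH d u (n + 1)} (hp : p ∈ bimoduleSpan d u n) :
    frame d u (n + 1) n * p ∈ bimoduleSpan d u n := by
  induction hp using AddSubmonoid.closure_induction with
  | mem x hx =>
    rcases hx with ⟨b, k, rfl⟩ | ⟨m, rfl, b, c, rfl⟩
    · rw [← mul_assoc, ← (commute_incl_frame _).eq, mul_assoc, frame_mul_frameIdem, mul_smul_comm]
      exact smul_mem _ (incl_mul_frameIdem_mem _ _)
    · rw [← mul_assoc, ← mul_assoc, ← (commute_incl_frame _).eq, mul_assoc (incl _ _ _ _),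
        frame_succ_mul_braid, ← incl_frame (by omega), ← mul_assoc, mul_assoc, ← map_mul]
      exact incl_mul_braid_mul_incl_mem rfl _ _
  | zero => simp
  | add x y _ _ hx hy => rw [mul_add]; exact add_mem hx hy

theorem braid_mul_mem {m : ℕ} (h : m + 1 = n)
    (sandwich_mem : ∀ b,
      braid d u (n + 1) m * incl d u n b * braid d u (n + 1) m ∈ bimoduleSpan d u n)
    {p : YH d u (n + 1)} (hp : p ∈ bimoduleSpan d u n) :
    braid d u (n + 1) m * p ∈ bimoduleSpan d u n := by
  induction hp using AddSubmonoid.closure_induction with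
  | mem x hx =>
    rcases hx with ⟨b, k, rfl⟩ | ⟨m', h', b, c, rfl⟩
    · subst h
      rw [(commute_incl_frameIdem _ _).eq, ← mul_assoc, braid_mul_frameIdem_succ,
        ← incl_frameIdem _ (by omega)]
      exact incl_mul_braid_mul_incl_mem rfl _ _
    · obtain rfl : m' = m := by omega
      rw [← mul_assoc, ← mul_assoc]
      exact mul_incl_mem _ (sandwich_mem b)
  | zero => simp
  | add x y _ _ hx hy => rw [mul_add]; exact add_mem hx hy

theorem mem_of_sandwich_mem
    (sandwich_mem : ∀ m, m + 1 = n → ∀ b,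
      braid d u (n + 1) m * incl d u n b * braid d u (n + 1) m ∈ bimoduleSpan d u n)
    (a : YH d u (n + 1)) : a ∈ bimoduleSpan d u n := by
  suffices ∀ p ∈ bimoduleSpan d u n, a * p ∈ bimoduleSpan d u n by
    simpa using this 1 one_mem
  induction a using induction with
  | hc c => intro p hp; rw [← Algebra.smul_def]; exact smul_mem c hp
  | hadd a b ha hb => intro p hp; rw [add_mul]; exact add_mem (ha p hp) (hb p hp)
  | hmul a b ha hb => intro p hp; rw [mul_assoc]; exact ha _ (hb p hp)
  | hg i hi =>
    intro p hp
    by_cases h : i + 1 < n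
    · rw [← incl_braid h]; exact incl_mul_mem _ hp
    · exact braid_mul_mem (by omega) (sandwich_mem i (by omega)) hp
  | ht j hj =>
    intro p hp
    by_cases h : j < n
    · rw [← incl_frame h]; exact incl_mul_mem _ hp
    · obtain rfl : j = n := by omega
      exact frame_mul_mem hp

theorem braid_mul_incl_mul_frameIdem_mul_braid_mem (b : YH d u n) (k : ZMod d) :
    braid d u (n + 2) n * incl d u (n + 1) (incl d u n b * frameIdem d u (n + 1) k n)
      * braid d u (n + 2) n ∈ bimoduleSpan d u (n + 1) := by
  have frameIdem_eq := incl_frameIdem (u := u) k n.lt_succ_self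
  rw [map_mul, ← mul_assoc, ← (commute_incl_incl_braid _).eq, frameIdem_eq, mul_assoc, mul_assoc,
    ← mul_assoc (braid _ _ _ _), braid_mul_frameIdem_mul_braid k (by omega), ← frameIdem_eq]
  exact incl_mul_mem _ (add_mem
    (add_mem (frameIdem_mem k) (smul_mem _ (incl_mul_frameIdem_mem _ k)))
    (smul_mem _ (incl_mul_braid_mul_incl_mem rfl _ _)))

theorem mem : ∀ {n : ℕ} (a : YH d u (n + 1)), a ∈ bimoduleSpan d u n := by
  intro n
  induction n with
  | zero => exact mem_of_sandwich_mem (by omega)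
  | succ n ih =>
    refine mem_of_sandwich_mem fun m hm b => ?_
    obtain rfl : m = n := by omega
    induction ih b using AddSubmonoid.closure_induction with
    | mem x hx =>
      rcases hx with ⟨b, k, rfl⟩ | ⟨m', rfl, b, c, rfl⟩
      · exact braid_mul_incl_mul_frameIdem_mul_braid_mem b k
      · rw [braid_mul_incl_mul_braid_mul_incl_mul_braid]
        exact incl_mul_braid_mul_incl_mem rfl _ _
    | zero => simp
    | add x y _ _ hx hy => rw [map_add, mul_add, add_mul]; exact add_mem hx hy

end bimoduleSpan

theorem induction_bimodule {P : YH d u (n + 1) → Prop}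
    (hadd : ∀ a b, P a → P b → P (a + b))
    (hframe : ∀ b k, P (incl d u n b * frameIdem d u (n + 1) k n))
    (hbraid : ∀ m, m + 1 = n → ∀ b c, P (incl d u n b * braid d u (n + 1) m * incl d u n c))
    (a : YH d u (n + 1)) : P a := by
  induction bimoduleSpan.mem a using AddSubmonoid.closure_induction with
  | mem x hx =>
    rcases hx with ⟨b, k, rfl⟩ | ⟨m, h, b, c, rfl⟩
    · exact hframe b k
    · exact hbraid m h b c
  | zero => simpa using hframe 0 0
  | add x y _ _ hx hy => exact hadd x y hx hy

end YH

end Generators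

section Skip

/-- For `j ≠ p`, the position of `j` in `ℕ` after the removal of `p`. -/
def skip (p j : ℕ) : ℕ := if j < p then j else j - 1

theorem skip_of_lt {p j : ℕ} (h : j < p) : skip p j = j := if_pos h

theorem skip_of_gt {p j : ℕ} (h : p < j) : skip p j = j - 1 := if_neg h.not_gt

theorem skip_succ {p j : ℕ} (h : p ≠ j) (h' : p ≠ j + 1) : skip p (j + 1) = skip p j + 1 := by
  grind [skip]

theorem skip_swap {p i j : ℕ} (h : p ≠ i) (h' : p ≠ i + 1) (hj : j ≠ p) :
    skip p (Equiv.swap i (i + 1) j) = Equiv.swap (skip p i) (skip p i + 1) (skip p j) := by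
  grind [skip]

end Skip

/-- Pointwise left multiplication on sequences in `A`, as an action by right `A`-linear maps. -/
noncomputable def pointwiseMul (A : Type*) [Ring A] [Algebra ℂ A] :
    (ℕ → A) →ₐ[ℂ] Module.End Aᵐᵒᵖ (ℕ → A) :=
  haveI : SMulCommClass (ℕ → A) Aᵐᵒᵖ (ℕ → A) :=
    ⟨fun _ _ _ => funext fun _ => (mul_assoc _ _ _).symm⟩
  Algebra.lsmul ℂ _ (ℕ → A)

theorem pointwiseMul_apply {A : Type*} [Ring A] [Algebra ℂ A] (a c : ℕ → A) (p : ℕ) :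
    pointwiseMul A a c p = a p * c p := rfl

section InducedRepresentation

namespace YH

variable {d : ℕ} [NeZero d] {u : ℂ} {n : ℕ}

/-- The sequence of coefficients by which `t_j` acts in the induced representation. -/
noncomputable def repCoeff (d : ℕ) [NeZero d] (u : ℂ) (n : ℕ) (k : ZMod d) (j p : ℕ) : YH d u n :=
  if n < p then 1 else if p = j then (ZMod.stdAddChar k : ℂ) • 1 else frame d u n (skip p j)

/-- The action of `t_j` in the representation of `Y_{d,n+1}(u)` that is induced from the character
`k` of `t_n`. The term `c p` of the sequence `c`, for `p ≤ n`, is the coefficient in `Y_{d,n}(u)` of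
the vector `E_k(t_p) g_p ⋯ g_{n-1}`. The terms with `n < p` play no role; the generators act on
them by `t_j ↦ 1` and `g_j ↦ u`. -/
noncomputable def repFrame (d : ℕ) [NeZero d] (u : ℂ) (n : ℕ) (k : ZMod d) (j : ℕ) :
    Module.End (YH d u n)ᵐᵒᵖ (ℕ → YH d u n) :=
  pointwiseMul _ (repCoeff d u n k j)

/-- The action of `g_j` in the induced representation of `Y_{d,n+1}(u)`. -/
noncomputable def repBraid (d : ℕ) [NeZero d] (u : ℂ) (n : ℕ) (k : ZMod d) (j : ℕ) :
    Module.End (YH d u n)ᵐᵒᵖ (ℕ → YH d u n) where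
  toFun c p :=
    if n < p then u • c p
    else if p = j then c (j + 1) + (u - 1) • (frameIdem d u n k j * c j)
    else if p = j + 1 then c j + (u - 1) • (frameIdem d u n k j * c j)
    else braid d u n (skip p j) * c p
  map_add' c c' := by
    ext p
    simp only [Pi.add_apply, mul_add, smul_add]
    split_ifs <;> abel
  map_smul' a c := by
    ext p
    simp only [Pi.smul_apply, mul_smul_comm, RingHom.id_apply]
    split_ifs <;> simp only [smul_add, smul_comm a]

theorem repFrame_apply (k : ZMod d) (j : ℕ) (c : ℕ → YH d u n) (p : ℕ) :
    repFrame d u n k j c p = repCoeff d u n k j p * c p := rfl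

theorem repBraid_apply_of_lt (k : ZMod d) (j : ℕ) (c : ℕ → YH d u n) {p : ℕ} (h : n < p) :
    repBraid d u n k j c p = u • c p := by
  simp [repBraid, h]

theorem repBraid_apply_self (k : ZMod d) {j : ℕ} (c : ℕ → YH d u n) (h : j ≤ n) :
    repBraid d u n k j c j = c (j + 1) + (u - 1) • (frameIdem d u n k j * c j) := by
  simp [repBraid, h.not_gt]

theorem repBraid_apply_succ (k : ZMod d) {j : ℕ} (c : ℕ → YH d u n) (h : j < n) :
    repBraid d u n k j c (j + 1) = c j + (u - 1) • (frameIdem d u n k j * c j) := by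
  simp [repBraid, h.not_ge]

theorem repBraid_apply_of_ne (k : ZMod d) {j : ℕ} (c : ℕ → YH d u n) {p : ℕ} (hp : p ≤ n)
    (h : p ≠ j) (h' : p ≠ j + 1) : repBraid d u n k j c p = braid d u n (skip p j) * c p := by
  simp [repBraid, hp.not_gt, h, h']

theorem repCoeff_of_lt (k : ZMod d) (j : ℕ) {p : ℕ} (h : n < p) : repCoeff d u n k j p = 1 := by
  simp [repCoeff, h]

theorem repCoeff_self (k : ZMod d) {j : ℕ} (h : j ≤ n) :
    repCoeff d u n k j j = (ZMod.stdAddChar k : ℂ) • 1 := by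
  simp [repCoeff, h.not_gt]

theorem repCoeff_of_ne (k : ZMod d) {j p : ℕ} (hp : p ≤ n) (h : p ≠ j) :
    repCoeff d u n k j p = frame d u n (skip p j) := by
  simp [repCoeff, hp.not_gt, h]

theorem commute_repCoeff (k : ZMod d) (i j : ℕ) :
    Commute (repCoeff d u n k i) (repCoeff d u n k j) := by
  ext p
  simp only [Pi.mul_apply, repCoeff]
  split_ifs <;> simp [(commute_frame _ _).eq]

theorem commute_repCoeff_frameIdem (k l : ZMod d) (i j p : ℕ) :
    Commute (repCoeff d u n k j p) (frameIdem d u n l i) := by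
  unfold repCoeff
  split_ifs
  · exact Commute.one_left _
  · exact (Commute.one_left _).smul_left _
  · exact commute_frame_frameIdem _ _ _

theorem repCoeff_pow_card (k : ZMod d) (j : ℕ) : repCoeff d u n k j ^ d = 1 := by
  ext p
  simp only [Pi.pow_apply, repCoeff, Pi.one_apply]
  split_ifs
  · exact one_pow d
  · exact smul_one_pow_card k
  · exact frame_pow_card _

theorem repCoeff_swap_succ (k : ZMod d) {i : ℕ} (hi : i < n) (j : ℕ) :
    repCoeff d u n k (Equiv.swap i (i + 1) j) (i + 1) = repCoeff d u n k j i := by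
  rcases eq_or_ne i j with rfl | hj
  · rw [Equiv.swap_apply_left, repCoeff_self k hi, repCoeff_self k hi.le]
  · have hs : i + 1 ≠ Equiv.swap i (i + 1) j := by grind
    have skip_eq : skip (i + 1) (Equiv.swap i (i + 1) j) = skip i j := by
      grind [skip]
    rw [repCoeff_of_ne k hi hs, repCoeff_of_ne k hi.le hj, skip_eq]

theorem repCoeff_swap_self (k : ZMod d) {i : ℕ} (hi : i < n) (j : ℕ) :
    repCoeff d u n k (Equiv.swap i (i + 1) j) i = repCoeff d u n k j (i + 1) := by
  rw [← repCoeff_swap_succ k hi, Equiv.swap_apply_self]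

theorem repCoeff_mul_frameIdem (k : ZMod d) {i : ℕ} (hi : i < n) (j : ℕ) :
    repCoeff d u n k j i * frameIdem d u n k i
      = repCoeff d u n k j (i + 1) * frameIdem d u n k i := by
  have scalar_eq : (ZMod.stdAddChar k : ℂ) • (1 : YH d u n) * frameIdem d u n k i
      = frame d u n i * frameIdem d u n k i := by
    rw [frame_mul_frameIdem, smul_mul_assoc, one_mul]
  rcases eq_or_ne i j with rfl | hj
  · rw [repCoeff_self k hi.le, repCoeff_of_ne k hi (by omega), skip_of_lt (by omega), scalar_eq]
  rcases eq_or_ne (i + 1) j with rfl | hj'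
  · rw [repCoeff_self k hi, repCoeff_of_ne k hi.le hj, skip_of_gt (by omega), scalar_eq,
      Nat.add_sub_cancel]
  · have skip_eq : skip i j = skip (i + 1) j := by grind [skip]
    rw [repCoeff_of_ne k hi hj', repCoeff_of_ne k hi.le hj, skip_eq]

theorem repCoeff_mul_braid (k : ZMod d) {i p : ℕ} (hp : p ≤ n) (h : p ≠ i) (h' : p ≠ i + 1)
    (j : ℕ) :
    repCoeff d u n k j p * braid d u n (skip p i)
      = braid d u n (skip p i) * repCoeff d u n k (Equiv.swap i (i + 1) j) p := by
  rcases eq_or_ne p j with rfl | hj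
  · simp [Equiv.swap_apply_of_ne_of_ne h h', repCoeff_self k hp]
  · have hs : p ≠ Equiv.swap i (i + 1) j := by grind
    rw [repCoeff_of_ne k hp hj, repCoeff_of_ne k hp hs, frame_mul_braid, skip_swap h h' hj.symm]

theorem repFrame_pow_card (k : ZMod d) (j : ℕ) : repFrame d u n k j ^ d = 1 := by
  rw [repFrame, ← map_pow, repCoeff_pow_card, map_one]

theorem commute_repFrame (k : ZMod d) (i j : ℕ) :
    Commute (repFrame d u n k i) (repFrame d u n k j) :=
  (commute_repCoeff k i j).map (pointwiseMul _)

theorem repFrame_mul_repBraid (k : ZMod d) {i : ℕ} (hi : i < n) (j : ℕ) :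
    repFrame d u n k j * repBraid d u n k i
      = repBraid d u n k i * repFrame d u n k (Equiv.swap i (i + 1) j) := by
  refine LinearMap.ext fun c => funext fun p => ?_
  simp only [Module.End.mul_apply, repFrame_apply]
  rcases lt_or_ge n p with hp | hp
  · simp only [repBraid_apply_of_lt k _ _ hp, repCoeff_of_lt k _ hp, repFrame_apply, one_mul]
  have comm_right := (commute_repCoeff_frameIdem (u := u) (n := n) k k i j (i + 1)).eq
  rcases eq_or_ne p i with rfl | h
  · rw [repBraid_apply_self k _ hp, repBraid_apply_self k _ hp, repFrame_apply, repFrame_apply,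
      repCoeff_swap_succ k hi, repCoeff_swap_self k hi, mul_add, mul_smul_comm, ← mul_assoc,
      ← mul_assoc, repCoeff_mul_frameIdem k hi, comm_right]
  rcases eq_or_ne p (i + 1) with rfl | h'
  · rw [repBraid_apply_succ k _ hp, repBraid_apply_succ k _ hp, repFrame_apply,
      repCoeff_swap_self k hi, mul_add, mul_smul_comm, ← mul_assoc, ← mul_assoc, comm_right]
  · rw [repBraid_apply_of_ne k _ hp h h', repBraid_apply_of_ne k _ hp h h', repFrame_apply,
      ← mul_assoc, ← mul_assoc, repCoeff_mul_braid k hp h h']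

/-- The sequence of coefficients by which `e_i` acts in the induced representation. -/
noncomputable def repTie (d : ℕ) [NeZero d] (u : ℂ) (n : ℕ) (k : ZMod d) (i p : ℕ) : YH d u n :=
  yhE d (repCoeff d u n k i p) (repCoeff d u n k (i + 1) p)

theorem yhE_repFrame_apply (k : ZMod d) (i : ℕ) (c : ℕ → YH d u n) (p : ℕ) :
    yhE d (repFrame d u n k i) (repFrame d u n k (i + 1)) c p = repTie d u n k i p * c p := by
  rw [repFrame, repFrame, ← map_yhE, pointwiseMul_apply]
  congr 1
  exact map_yhE d (Pi.evalAlgHom ℂ (fun _ : ℕ => YH d u n) p) _ _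

theorem repTie_of_lt (k : ZMod d) (i : ℕ) {p : ℕ} (h : n < p) : repTie d u n k i p = 1 := by
  rw [repTie, repCoeff_of_lt k _ h, repCoeff_of_lt k _ h, yhE_one_one]

theorem repTie_self (k : ZMod d) {i : ℕ} (h : i ≤ n) :
    repTie d u n k i i = frameIdem d u n k i := by
  rw [repTie, repCoeff_self k h, repCoeff_of_ne k h (by omega), skip_of_gt (by omega),
    yhE_smul_one_left (frame_pow_card _), Nat.add_sub_cancel, frameIdem]

theorem repTie_succ (k : ZMod d) {i : ℕ} (h : i < n) :
    repTie d u n k i (i + 1) = frameIdem d u n k i := by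
  rw [repTie, repCoeff_self k h, repCoeff_of_ne k h (by omega), skip_of_lt (by omega),
    yhE_smul_one_right (frame_pow_card _), frameIdem]

theorem repTie_of_ne (k : ZMod d) {i p : ℕ} (hp : p ≤ n) (h : p ≠ i) (h' : p ≠ i + 1) :
    repTie d u n k i p = tie d u n (skip p i) := by
  rw [repTie, repCoeff_of_ne k hp h, repCoeff_of_ne k hp h', skip_succ h h', tie]

theorem repBraid_mul_self (k : ZMod d) {i : ℕ} (hi : i < n) :
    repBraid d u n k i * repBraid d u n k i
      = 1 + (u - 1) • yhE d (repFrame d u n k i) (repFrame d u n k (i + 1))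
        + (u - 1) • (yhE d (repFrame d u n k i) (repFrame d u n k (i + 1))
          * repBraid d u n k i) := by
  refine LinearMap.ext fun c => funext fun p => ?_
  simp only [Module.End.mul_apply, LinearMap.add_apply, LinearMap.smul_apply, Module.End.one_apply,
    Pi.add_apply, Pi.smul_apply, yhE_repFrame_apply]
  rcases lt_or_ge n p with hp | hp
  · simp only [repBraid_apply_of_lt k _ _ hp, repTie_of_lt k _ hp, one_mul]
    module
  rcases eq_or_ne p i with rfl | h
  · simp only [repBraid_apply_self k _ hp, repTie_self k hp, repBraid_apply_succ k _ hi]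
  rcases eq_or_ne p (i + 1) with rfl | h'
  · simp only [repBraid_apply_self k _ hi.le, repTie_succ k hp, repBraid_apply_succ k _ hp,
      mul_add, mul_smul_comm, ← mul_assoc, frameIdem_mul_self]
    module
  · have skip_lt : skip p i + 1 < n := by grind [skip]
    simp only [repBraid_apply_of_ne k _ hp h h', repTie_of_ne k hp h h']
    rw [← mul_assoc, braid_mul_self skip_lt]
    simp only [add_mul, smul_mul_assoc, one_mul, mul_assoc]

theorem repBraid_comm_apply (k : ZMod d) {i j p : ℕ} (hij : i + 1 < j ∨ j + 1 < i) (hi : i < n)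
    (hp : p ≤ n) (h : p ≠ j) (h' : p ≠ j + 1) (c : ℕ → YH d u n) :
    repBraid d u n k i (repBraid d u n k j c) p = repBraid d u n k j (repBraid d u n k i c) p := by
  have skip_eq : skip (i + 1) j = skip i j := by grind [skip]
  have comm_idem : Commute (frameIdem d u n k i) (braid d u n (skip i j)) :=
    (commute_braid_frameIdem k (by grind [skip]) (by grind [skip])).symm
  rw [repBraid_apply_of_ne k _ hp h h']
  rcases eq_or_ne p i with rfl | hpi
  · rw [repBraid_apply_self k _ hp, repBraid_apply_self k _ hp, repBraid_apply_of_ne k _ hp h h',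
      repBraid_apply_of_ne k _ hi (by omega) (by omega), skip_eq, mul_add, mul_smul_comm,
      ← mul_assoc, comm_idem.eq, mul_assoc]
  rcases eq_or_ne p (i + 1) with rfl | hpi'
  · rw [repBraid_apply_succ k _ hp, repBraid_apply_succ k _ hp,
      repBraid_apply_of_ne k _ hi.le (by omega) (by omega), skip_eq, mul_add, mul_smul_comm,
      ← mul_assoc, comm_idem.eq, mul_assoc]
  · rw [repBraid_apply_of_ne k _ hp hpi hpi', repBraid_apply_of_ne k _ hp hpi hpi',
      repBraid_apply_of_ne k _ hp h h', ← mul_assoc, ← mul_assoc,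
      (commute_braid (by grind [skip])).eq]

theorem commute_repBraid (k : ZMod d) {i j : ℕ} (hi : i < n) (hj : j < n)
    (hij : i + 1 < j ∨ j + 1 < i) : Commute (repBraid d u n k i) (repBraid d u n k j) := by
  refine LinearMap.ext fun c => funext fun p => ?_
  simp only [Module.End.mul_apply]
  rcases lt_or_ge n p with hp | hp
  · simp only [repBraid_apply_of_lt k _ _ hp]
  by_cases h : p = j ∨ p = j + 1
  · exact (repBraid_comm_apply k hij.symm hj hp (by omega) (by omega) c).symm
  · exact repBraid_comm_apply k hij hi hp (by omega) (by omega) c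

theorem repBraid_braid_apply (k : ZMod d) {i p : ℕ} (hi : i + 1 < n)
    (hp : p = i ∨ p = i + 1 ∨ p = i + 2) (c : ℕ → YH d u n) :
    repBraid d u n k i (repBraid d u n k (i + 1) (repBraid d u n k i c)) p
      = repBraid d u n k (i + 1) (repBraid d u n k i (repBraid d u n k (i + 1) c)) p := by
  have at_i (c) : repBraid d u n k i c i = _ := repBraid_apply_self k c (by omega)
  have at_succ (c) : repBraid d u n k i c (i + 1) = _ := repBraid_apply_succ k c (by omega)
  have at_succ_succ (c) : repBraid d u n k i c (i + 2) = braid d u n i * c (i + 2) := by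
    rw [repBraid_apply_of_ne k c (by omega) (by omega) (by omega), skip_of_lt (by omega)]
  have succ_at_i (c) : repBraid d u n k (i + 1) c i = braid d u n i * c i := by
    rw [repBraid_apply_of_ne k c (by omega) (by omega) (by omega), skip_of_gt (by omega),
      Nat.add_sub_cancel]
  have succ_at_succ (c) : repBraid d u n k (i + 1) c (i + 1) = _ :=
    repBraid_apply_self k c (by omega)
  have succ_at_succ_succ (c) : repBraid d u n k (i + 1) c (i + 2) = _ :=
    repBraid_apply_succ k c (by omega)
  have braid_idem (x) : braid d u n i * (frameIdem d u n k i * x)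
      = frameIdem d u n k (i + 1) * (braid d u n i * x) := by
    rw [← mul_assoc, braid_mul_frameIdem, mul_assoc]
  have braid_idem_succ (x) : braid d u n i * (frameIdem d u n k (i + 1) * x)
      = frameIdem d u n k i * (braid d u n i * x) := by
    rw [← mul_assoc, braid_mul_frameIdem_succ, mul_assoc]
  have idem_comm (x) : frameIdem d u n k (i + 1) * (frameIdem d u n k i * x)
      = frameIdem d u n k i * (frameIdem d u n k (i + 1) * x) :=
    (commute_frameIdem k k (i + 1) i).left_comm x
  rcases hp with rfl | rfl | rfl <;>
  · simp only [at_i, at_succ, at_succ_succ, succ_at_i, succ_at_succ, succ_at_succ_succ, mul_add,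
      mul_smul_comm, smul_add, braid_idem, braid_idem_succ,
      frameIdem_succ_mul_braid_mul_braid_mul k hi, idem_comm]
    module

theorem repBraid_mul_repBraid_mul_repBraid (k : ZMod d) {i : ℕ} (hi : i + 1 < n) :
    repBraid d u n k i * repBraid d u n k (i + 1) * repBraid d u n k i
      = repBraid d u n k (i + 1) * repBraid d u n k i * repBraid d u n k (i + 1) := by
  refine LinearMap.ext fun c => funext fun p => ?_
  simp only [Module.End.mul_apply]
  rcases lt_or_ge n p with hp | hp
  · simp only [repBraid_apply_of_lt k _ _ hp]
  by_cases hpi : p = i ∨ p = i + 1 ∨ p = i + 2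
  · exact repBraid_braid_apply k hi hpi c
  · push Not at hpi
    obtain ⟨h, h', h''⟩ := hpi
    simp only [repBraid_apply_of_ne k _ hp h h', repBraid_apply_of_ne k _ hp h' h'',
      skip_succ h h', ← mul_assoc, braid_mul_braid_mul_braid]

/-- The action of the generators in the induced representation. -/
noncomputable def repGen (d : ℕ) [NeZero d] (u : ℂ) (n : ℕ) (k : ZMod d) :
    YHGen (n + 1) → Module.End (YH d u n)ᵐᵒᵖ (ℕ → YH d u n)
  | YHGen.g i _ => repBraid d u n k i
  | YHGen.t j _ => repFrame d u n k j

theorem repGen_rel (k : ZMod d) {a b : FreeAlgebra ℂ (YHGen (n + 1))}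
    (h : YHRel d u (n + 1) a b) :
    FreeAlgebra.lift ℂ (repGen d u n k) a = FreeAlgebra.lift ℂ (repGen d u n k) b := by
  induction h with
  | far i j hi hj hij =>
    simpa [YHGen.G, repGen] using (commute_repBraid k (by omega) (by omega) hij).eq
  | braid i hi =>
    simpa [YHGen.G, repGen] using repBraid_mul_repBraid_mul_repBraid k (by omega)
  | frame_comm i j hi hj => simpa [YHGen.T, repGen] using (commute_repFrame k i j).eq
  | frame_braid i j hi hj =>
    simpa [YHGen.T, YHGen.G, repGen] using repFrame_mul_repBraid k (by omega) j
  | frame_pow j hj => simpa [YHGen.T, repGen] using repFrame_pow_card k j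
  | quadratic i hi =>
    have lift_yhE : FreeAlgebra.lift ℂ (repGen d u n k) (yhE d (YHGen.T i (by omega))
        (YHGen.T (i + 1) hi)) = yhE d (repFrame d u n k i) (repFrame d u n k (i + 1)) :=
      (map_yhE d (FreeAlgebra.lift ℂ (repGen d u n k)) _ _).trans (by simp [YHGen.T, repGen])
    simp only [map_add, map_mul, map_pow, map_one, map_smul, lift_yhE]
    simpa [YHGen.G, repGen, pow_two] using repBraid_mul_self k (by omega)

/-- The induced representation of `Y_{d,n+1}(u)` by right `Y_{d,n}(u)`-linear maps. -/
noncomputable def rep (d : ℕ) [NeZero d] (u : ℂ) (n : ℕ) (k : ZMod d) :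
    YH d u (n + 1) →ₐ[ℂ] Module.End (YH d u n)ᵐᵒᵖ (ℕ → YH d u n) :=
  RingQuot.liftAlgHom ℂ ⟨FreeAlgebra.lift ℂ (repGen d u n k), fun _ _ h => repGen_rel k h⟩

theorem rep_braid (k : ZMod d) {i : ℕ} (h : i < n) :
    rep d u n k (braid d u (n + 1) i) = repBraid d u n k i := by
  rw [← g_eq_braid (by omega)]
  simp [rep, g, YHGen.G, repGen]

theorem rep_frame (k : ZMod d) {j : ℕ} (h : j ≤ n) :
    rep d u n k (frame d u (n + 1) j) = repFrame d u n k j := by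
  rw [← t_eq_frame (by omega)]
  simp [rep, t, YHGen.T, repGen]

end YH

end InducedRepresentation

section ConditionalExpectation

theorem sum_range_congr_of_pair {M : Type*} [AddCommMonoid M] {f h : ℕ → M} {n j : ℕ}
    (hj : j + 1 < n) (hne : ∀ i < n, i ≠ j → i ≠ j + 1 → f i = h i)
    (pair_eq : f j + f (j + 1) = h j + h (j + 1)) :
    ∑ i ∈ Finset.range n, f i = ∑ i ∈ Finset.range n, h i := by
  have pair_subset : ({j, j + 1} : Finset ℕ) ⊆ Finset.range n := by grind
  rw [← Finset.sum_sdiff pair_subset, ← Finset.sum_sdiff pair_subset, Finset.sum_pair (by omega),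
    Finset.sum_pair (by omega), pair_eq]
  congr 1
  exact Finset.sum_congr rfl fun i hi => hne i (by grind) (by grind) (by grind)

namespace YH

variable {d : ℕ} {u : ℂ} {n : ℕ}

/-- The product `g_i g_{i+1} ⋯ g_{i+l-1}`. -/
noncomputable def braidProd (d : ℕ) (u : ℂ) (n : ℕ) : ℕ → ℕ → YH d u n
  | 0, _ => 1
  | l + 1, i => braid d u n i * braidProd d u n l (i + 1)

theorem frame_mul_braidProd {i j l : ℕ} (h : j ≠ i) (hl : j ≤ i + l) :
    frame d u n j * braidProd d u n l i = braidProd d u n l i * frame d u n (skip i j) := by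
  induction l generalizing i j with
  | zero => simp [braidProd, skip_of_lt (show j < i by omega)]
  | succ l ih =>
    rw [braidProd, ← mul_assoc, mul_assoc _ _ (frame d u n _)]
    rcases eq_or_ne j (i + 1) with rfl | h'
    · rw [frame_succ_mul_braid, mul_assoc, ih (by omega) (by omega), skip_of_lt (by omega),
        skip_of_gt (by omega), Nat.add_sub_cancel]
    · have skip_eq : skip (i + 1) j = skip i j := by grind [skip]
      rw [(commute_frame_braid h h').eq, mul_assoc, ih h' (by omega), skip_eq]

theorem commute_braid_braidProd {i j : ℕ} (l : ℕ) (h : j + 1 < i) :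
    Commute (braid d u n j) (braidProd d u n l i) := by
  induction l generalizing i with
  | zero => exact Commute.one_right _
  | succ l ih => exact (commute_braid (Or.inl h)).mul_right (ih (by omega))

theorem braid_mul_braidProd {i j l : ℕ} (h : j ≠ i) (h' : j + 1 ≠ i) (hl : j + 1 ≤ i + l) :
    braid d u n j * braidProd d u n l i = braidProd d u n l i * braid d u n (skip i j) := by
  induction l generalizing i with
  | zero => simp [braidProd, skip_of_lt (show j < i by omega)]
  | succ l ih =>
    rcases eq_or_ne j (i + 1) with rfl | hj
    · obtain ⟨l, rfl⟩ : ∃ l', l = l' + 1 := ⟨l - 1, by omega⟩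
      rw [braidProd, braidProd, skip_of_gt (by omega), Nat.add_sub_cancel, ← mul_assoc,
        ← mul_assoc, ← braid_mul_braid_mul_braid, mul_assoc,
        (commute_braid_braidProd l (by omega)).eq]
      simp only [mul_assoc]
    · have skip_eq : skip (i + 1) j = skip i j := by grind [skip]
      rw [braidProd, ← mul_assoc, (commute_braid (by omega)).eq, mul_assoc,
        ih hj (by omega) (by omega), skip_eq, mul_assoc]

theorem braidProd_sub_one_sub {j : ℕ} (h : j + 1 < n) :
    braidProd d u n (n - 1 - j) j
      = braid d u n j * braidProd d u n (n - 1 - (j + 1)) (j + 1) := by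
  rw [show n - 1 - j = (n - 1 - (j + 1)) + 1 by omega, braidProd]

theorem smul_single_one (b : YH d u n) :
    MulOpposite.op b • (Pi.single n 1 : ℕ → YH d u n) = (Pi.single n b : ℕ → YH d u n) := by
  rw [← Pi.single_smul, op_smul_eq_mul, one_mul]

variable [NeZero d]

/-- The element `E_k(t_i) g_i ⋯ g_{n-2}` of `Y_{d,n}(u)`. -/
noncomputable def chain (d : ℕ) [NeZero d] (u : ℂ) (n : ℕ) (k : ZMod d) (i : ℕ) : YH d u n :=
  frameIdem d u n k i * braidProd d u n (n - 1 - i) i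

theorem frame_mul_chain (k : ZMod d) {i j : ℕ} (hi : i < n) (hj : j < n) :
    frame d u n j * chain d u n k i = chain d u n k i * repCoeff d u n k j i := by
  rcases eq_or_ne i j with rfl | h
  · rw [chain, repCoeff_self k hi.le, ← mul_assoc, frame_mul_frameIdem, smul_mul_assoc,
      mul_smul_comm, mul_one]
  · rw [chain, repCoeff_of_ne k hi.le h, ← mul_assoc, (commute_frame_frameIdem _ _ _).eq,
      mul_assoc, frame_mul_braidProd h.symm (by omega), mul_assoc]

theorem braid_mul_chain_of_ne (k : ZMod d) {i j : ℕ} (hi : i ≠ j) (hi' : i ≠ j + 1)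
    (hj : j + 1 < n) :
    braid d u n j * chain d u n k i = chain d u n k i * braid d u n (skip i j) := by
  rw [chain, ← mul_assoc, (commute_braid_frameIdem k hi hi').eq, mul_assoc,
    braid_mul_braidProd hi.symm hi'.symm (by omega), mul_assoc]

theorem braid_mul_chain_succ (k : ZMod d) {j : ℕ} (h : j + 1 < n) :
    braid d u n j * chain d u n k (j + 1) = chain d u n k j := by
  rw [chain, chain, ← mul_assoc, braid_mul_frameIdem_succ, mul_assoc, braidProd_sub_one_sub h]

theorem braid_mul_chain_self (k : ZMod d) {j : ℕ} (h : j + 1 < n) :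
    braid d u n j * chain d u n k j = chain d u n k (j + 1)
      + (u - 1) • (chain d u n k (j + 1) * frameIdem d u n k j)
      + (u - 1) • (chain d u n k j * frameIdem d u n k j) := by
  have prod_comm : Commute (braidProd d u n (n - 1 - (j + 1)) (j + 1)) (frameIdem d u n k j) := by
    refine semiconjBy_eigenIdem ?_ k
    rw [SemiconjBy, frame_mul_braidProd (by omega) (by omega), skip_of_lt (Nat.lt_succ_self j)]
  rw [chain, braidProd_sub_one_sub h, ← mul_assoc, ← mul_assoc, braid_mul_frameIdem_mul_braid k h,
    (commute_frameIdem k k j (j + 1)).eq]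
  simp only [chain, add_mul, smul_mul_assoc, mul_assoc, prod_comm.eq]

/-- The contribution of the induced representation with character `k` to the conditional
expectation: it sends the vector `E_k(t_n)` to `w` and the vectors `E_k(t_p) g_p ⋯ g_{n-1}` with
`p < n` to `z E_k(t_p) g_p ⋯ g_{n-2}`. -/
noncomputable def repEval (d : ℕ) [NeZero d] (u : ℂ) (n : ℕ) (z w : ℂ) (k : ZMod d) :
    (ℕ → YH d u n) →ₗ[(YH d u n)ᵐᵒᵖ] YH d u n where
  toFun c := w • c n + z • ∑ i ∈ Finset.range n, chain d u n k i * c i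
  map_add' c c' := by
    simp only [Pi.add_apply, mul_add, Finset.sum_add_distrib, smul_add]; abel
  map_smul' a c := by
    simp only [Pi.smul_apply, mul_smul_comm, ← Finset.smul_sum, smul_comm _ a, RingHom.id_apply,
      smul_add]

theorem repEval_apply (z w : ℂ) (k : ZMod d) (c : ℕ → YH d u n) :
    repEval d u n z w k c = w • c n + z • ∑ i ∈ Finset.range n, chain d u n k i * c i := rfl

theorem repEval_repFrame (z w : ℂ) (k : ZMod d) (c : ℕ → YH d u n) {j : ℕ} (hj : j < n) :
    repEval d u n z w k (repFrame d u n k j c) = frame d u n j * repEval d u n z w k c := by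
  rw [repEval_apply, repEval_apply, repFrame_apply, repCoeff_of_ne k le_rfl hj.ne', skip_of_lt hj,
    mul_add, mul_smul_comm, mul_smul_comm, Finset.mul_sum]
  congr 2
  refine Finset.sum_congr rfl fun i hi => ?_
  rw [repFrame_apply, ← mul_assoc, ← mul_assoc, frame_mul_chain k (Finset.mem_range.mp hi) hj]

theorem repEval_repBraid (z w : ℂ) (k : ZMod d) (c : ℕ → YH d u n) {j : ℕ} (hj : j + 1 < n) :
    repEval d u n z w k (repBraid d u n k j c) = braid d u n j * repEval d u n z w k c := by
  rw [repEval_apply, repEval_apply, repBraid_apply_of_ne k c le_rfl (by omega) (by omega),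
    skip_of_lt (by omega), mul_add, mul_smul_comm, mul_smul_comm, Finset.mul_sum]
  congr 2
  refine sum_range_congr_of_pair hj (fun i hi h h' => ?_) ?_
  · rw [repBraid_apply_of_ne k c hi.le h h', ← mul_assoc, ← mul_assoc,
      braid_mul_chain_of_ne k h h' hj]
  · rw [repBraid_apply_self k c (by omega), repBraid_apply_succ k c (by omega), ← mul_assoc,
      ← mul_assoc, braid_mul_chain_succ k hj, braid_mul_chain_self k hj]
    simp only [mul_add, add_mul, mul_smul_comm, smul_mul_assoc, mul_assoc]
    abel

theorem repEval_rep_incl (z w : ℂ) (k : ZMod d) (a : YH d u n) (c : ℕ → YH d u n) :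
    repEval d u n z w k (rep d u n k (incl d u n a) c) = a * repEval d u n z w k c := by
  induction a using induction generalizing c with
  | hc r =>
    rw [AlgHom.commutes, AlgHom.commutes, Module.algebraMap_end_apply, LinearMap.map_smul_of_tower,
      Algebra.smul_def]
  | hadd a b ha hb => simp only [map_add, LinearMap.add_apply, ha, hb, add_mul]
  | hmul a b ha hb => simp only [map_mul, Module.End.mul_apply, ha, hb, mul_assoc]
  | hg i hi => rw [incl_braid hi, rep_braid k (by omega), repEval_repBraid z w k c hi]
  | ht j hj => rw [incl_frame hj, rep_frame k hj.le, repEval_repFrame z w k c hj]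

theorem repBraid_single (k : ZMod d) {j : ℕ} (hj : j + 1 < n) :
    repBraid d u n k j (Pi.single n 1) = (Pi.single n (braid d u n j) : ℕ → YH d u n) := by
  ext p
  rcases lt_or_ge n p with hp | hp
  · simp [repBraid_apply_of_lt k _ _ hp, hp.ne']
  rcases eq_or_ne p j with rfl | h
  · simp [repBraid_apply_self k _ hp, hj.ne, show p ≠ n by omega]
  rcases eq_or_ne p (j + 1) with rfl | h'
  · simp [repBraid_apply_succ k _ hp, hj.ne, show j ≠ n by omega]
  rw [repBraid_apply_of_ne k _ hp h h']
  rcases eq_or_ne p n with rfl | hp'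
  · simp [skip_of_lt (show j < p by omega)]
  · simp [hp']

theorem repFrame_single (k : ZMod d) {j : ℕ} (hj : j < n) :
    repFrame d u n k j (Pi.single n 1) = (Pi.single n (frame d u n j) : ℕ → YH d u n) := by
  ext p
  rw [repFrame_apply]
  rcases eq_or_ne p n with rfl | hp
  · simp [repCoeff_of_ne k le_rfl hj.ne', skip_of_lt hj]
  · simp [hp]

theorem rep_incl_single (k : ZMod d) (b : YH d u n) :
    rep d u n k (incl d u n b) (Pi.single n 1) = (Pi.single n b : ℕ → YH d u n) := by
  induction b using induction with
  | hc r =>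
    rw [AlgHom.commutes, AlgHom.commutes, Module.algebraMap_end_apply, ← Pi.single_smul,
      Algebra.algebraMap_eq_smul_one]
  | hadd a b ha hb => rw [map_add, map_add, LinearMap.add_apply, ha, hb, Pi.single_add]
  | hmul a b ha hb =>
    rw [map_mul, map_mul, Module.End.mul_apply, hb, ← smul_single_one b, map_smul, ha,
      ← smul_single_one a, smul_smul, ← MulOpposite.op_mul, smul_single_one]
  | hg j hj => rw [incl_braid hj, rep_braid k (by omega), repBraid_single k hj]
  | ht j hj => rw [incl_frame hj, rep_frame k hj.le, repFrame_single k hj]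

/-- The conditional expectation `Y_{d,n+1}(u) → Y_{d,n}(u)` for the Juyumaya trace: the map of
bimodules with `E_k(t_n) ↦ w_k` and `g_{n-1} ↦ z`. -/
noncomputable def condExp (d : ℕ) [NeZero d] (u z : ℂ) (w : ZMod d → ℂ) (n : ℕ) :
    YH d u (n + 1) →ₗ[ℂ] YH d u n where
  toFun a := ∑ k : ZMod d, repEval d u n z (w k) k (rep d u n k a (Pi.single n 1))
  map_add' a b := by simp only [map_add, LinearMap.add_apply, Finset.sum_add_distrib]
  map_smul' c a := by
    simp only [map_smul, LinearMap.smul_apply, LinearMap.map_smul_of_tower, Finset.smul_sum,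
      RingHom.id_apply]

theorem condExp_apply (z : ℂ) (w : ZMod d → ℂ) (a : YH d u (n + 1)) :
    condExp d u z w n a
      = ∑ k : ZMod d, repEval d u n z (w k) k (rep d u n k a (Pi.single n 1)) := rfl

theorem condExp_incl_mul (z : ℂ) (w : ZMod d → ℂ) (a : YH d u n) (b : YH d u (n + 1)) :
    condExp d u z w n (incl d u n a * b) = a * condExp d u z w n b := by
  simp only [condExp_apply, map_mul, Module.End.mul_apply, repEval_rep_incl, Finset.mul_sum]

theorem condExp_mul_incl (z : ℂ) (w : ZMod d → ℂ) (a : YH d u (n + 1)) (b : YH d u n) :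
    condExp d u z w n (a * incl d u n b) = condExp d u z w n a * b := by
  simp only [condExp_apply, map_mul, Module.End.mul_apply, rep_incl_single, Finset.sum_mul]
  simp only [← smul_single_one b, map_smul, op_smul_eq_mul]

theorem rep_frameIdem_single (k l : ZMod d) :
    rep d u n k (frameIdem d u (n + 1) l n) (Pi.single n 1)
      = if l = k then Pi.single n 1 else 0 := by
  have rep_eq : rep d u n k (frameIdem d u (n + 1) l n)
      = pointwiseMul _ (eigenIdem l (repCoeff d u n k n)) := by
    simp only [frameIdem, eigenIdem, map_smul, map_sum, map_pow, rep_frame k le_rfl, repFrame]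
  have eigenIdem_apply : eigenIdem l (repCoeff d u n k n) n = if l = k then 1 else 0 := by
    rw [← eigenIdem_smul_one (A := YH d u n) l k, ← repCoeff_self k le_rfl]
    exact map_eigenIdem (Pi.evalAlgHom ℂ (fun _ : ℕ => YH d u n) n) l _
  ext p
  rw [rep_eq, pointwiseMul_apply]
  rcases eq_or_ne p n with rfl | hp
  · rw [eigenIdem_apply]
    split_ifs <;> simp
  · split_ifs <;> simp [hp]

theorem repEval_single (z w : ℂ) (k : ZMod d) :
    repEval d u n z w k (Pi.single n 1) = algebraMap ℂ _ w := by
  rw [repEval_apply, Finset.sum_eq_zero fun i hi => ?_]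
  · simp [Algebra.algebraMap_eq_smul_one]
  · simp [(Finset.mem_range.mp hi).ne]

theorem condExp_frameIdem (z : ℂ) (w : ZMod d → ℂ) (k : ZMod d) :
    condExp d u z w n (frameIdem d u (n + 1) k n) = algebraMap ℂ _ (w k) := by
  simp [condExp_apply, rep_frameIdem_single, apply_ite, repEval_single]

theorem repBraid_last_single (k : ZMod d) :
    repBraid d u (n + 1) k n (Pi.single (n + 1) 1) = Pi.single n 1 := by
  ext p
  rcases lt_or_ge (n + 1) p with hp | hp
  · simp [repBraid_apply_of_lt k _ _ hp, hp.ne', show p ≠ n by omega]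
  rcases eq_or_ne p n with rfl | h
  · simp [repBraid_apply_self k _ hp]
  rcases eq_or_ne p (n + 1) with rfl | h'
  · simp [repBraid_apply_succ k _ hp]
  · simp [repBraid_apply_of_ne k _ hp h h', h, h']

theorem repEval_single_last (z w : ℂ) (k : ZMod d) :
    repEval d u (n + 1) z w k (Pi.single n 1) = z • frameIdem d u (n + 1) k n := by
  rw [repEval_apply, Finset.sum_eq_single n (fun i _ hi => by simp [hi]) (by simp)]
  simp [chain, braidProd]

theorem condExp_braid (z : ℂ) (w : ZMod d → ℂ) :
    condExp d u z w (n + 1) (braid d u (n + 2) n) = algebraMap ℂ _ z := by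
  simp only [condExp_apply, rep_braid _ (Nat.lt_succ_self n), repBraid_last_single,
    repEval_single_last]
  rw [← Finset.smul_sum, sum_frameIdem, Algebra.algebraMap_eq_smul_one]

end YH

end ConditionalExpectation

section Trace

namespace YH

variable {d : ℕ} {u : ℂ} {n : ℕ}

/-- The isomorphism of `Y_{d,0}(u)` with `ℂ`, as a homomorphism. -/
noncomputable def aug (d : ℕ) (u : ℂ) : YH d u 0 →ₐ[ℂ] ℂ :=
  RingQuot.liftAlgHom ℂ ⟨FreeAlgebra.lift ℂ fun _ => 0, fun a b h => by cases h <;> omega⟩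

variable [NeZero d]

theorem frameIdem_mul_incl_mul_braid_mul_incl (k : ZMod d) (a b : YH d u (n + 1)) :
    frameIdem d u (n + 2) k (n + 1)
        * (incl d u (n + 1) a * braid d u (n + 2) n * incl d u (n + 1) b)
      = incl d u (n + 1) a * braid d u (n + 2) n
        * incl d u (n + 1) (frameIdem d u (n + 1) k n * b) := by
  rw [← mul_assoc, ← mul_assoc, ← (commute_incl_frameIdem a k).eq, mul_assoc (incl _ _ _ a),
    ← braid_mul_frameIdem, map_mul, incl_frameIdem k n.lt_succ_self]
  simp only [mul_assoc]

theorem incl_mul_braid_mul_incl_mul_frameIdem (k : ZMod d) (a b : YH d u (n + 1)) :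
    incl d u (n + 1) a * braid d u (n + 2) n * incl d u (n + 1) b
        * frameIdem d u (n + 2) k (n + 1)
      = incl d u (n + 1) (a * frameIdem d u (n + 1) k n) * braid d u (n + 2) n
        * incl d u (n + 1) b := by
  rw [mul_assoc, (commute_incl_frameIdem b k).eq, ← mul_assoc, mul_assoc (incl _ _ _ a),
    braid_mul_frameIdem_succ, map_mul, incl_frameIdem k n.lt_succ_self]
  simp only [mul_assoc]

/-- The trace on `Y_{d,n}(u)` that is composed of the conditional expectations. -/
noncomputable def jtrace (d : ℕ) [NeZero d] (u z : ℂ) (w : ZMod d → ℂ) :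
    ∀ n : ℕ, YH d u n →ₗ[ℂ] ℂ
  | 0 => (aug d u).toLinearMap
  | n + 1 => jtrace d u z w n ∘ₗ condExp d u z w n

variable (z : ℂ) (w : ZMod d → ℂ)

theorem jtrace_succ (a : YH d u (n + 1)) :
    jtrace d u z w (n + 1) a = jtrace d u z w n (condExp d u z w n a) := rfl

theorem condExp_incl_mul_braid_mul_incl (a b : YH d u (n + 1)) :
    condExp d u z w (n + 1) (incl d u (n + 1) a * braid d u (n + 2) n * incl d u (n + 1) b)
      = z • (a * b) := by
  rw [condExp_mul_incl, condExp_incl_mul, condExp_braid, ← Algebra.commutes, ← Algebra.smul_def,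
    smul_mul_assoc]

theorem condExp_incl_mul_frameIdem (a : YH d u n) (k : ZMod d) :
    condExp d u z w n (incl d u n a * frameIdem d u (n + 1) k n) = w k • a := by
  rw [condExp_incl_mul, condExp_frameIdem, ← Algebra.commutes, ← Algebra.smul_def]

theorem jtrace_incl_mul_braid_mul_incl (a b : YH d u (n + 1)) :
    jtrace d u z w (n + 2) (incl d u (n + 1) a * braid d u (n + 2) n * incl d u (n + 1) b)
      = z * jtrace d u z w (n + 1) (a * b) := by
  rw [jtrace_succ, condExp_incl_mul_braid_mul_incl, map_smul, smul_eq_mul]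

theorem jtrace_incl_mul_frameIdem (a : YH d u n) (k : ZMod d) :
    jtrace d u z w (n + 1) (incl d u n a * frameIdem d u (n + 1) k n)
      = w k * jtrace d u z w n a := by
  rw [jtrace_succ, condExp_incl_mul_frameIdem, map_smul, smul_eq_mul]

/-- The map `a ↦ E(g_n ι(a) g_n)` for the conditional expectation `E`. For `a` and `b` in
`Y_{d,n}(u)` and the trace `τ`, we have `τ(ι(a) g_n ι(b) g_n) = τ(a E(g_n ι(b) g_n))`. -/
noncomputable def sandwichExp (d : ℕ) [NeZero d] (u z : ℂ) (w : ZMod d → ℂ) (n : ℕ) :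
    YH d u (n + 1) →ₗ[ℂ] YH d u (n + 1) :=
  condExp d u z w (n + 1) ∘ₗ
    LinearMap.mulLeftRight ℂ (braid d u (n + 2) n, braid d u (n + 2) n) ∘ₗ
    (incl d u (n + 1)).toLinearMap

theorem sandwichExp_apply (a : YH d u (n + 1)) :
    sandwichExp d u z w n a = condExp d u z w (n + 1)
      (braid d u (n + 2) n * incl d u (n + 1) a * braid d u (n + 2) n) := rfl

theorem sandwichExp_incl_mul (a : YH d u n) (b : YH d u (n + 1)) :
    sandwichExp d u z w n (incl d u n a * b) = incl d u n a * sandwichExp d u z w n b := by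
  rw [sandwichExp_apply, sandwichExp_apply, ← condExp_incl_mul, map_mul (incl d u _),
    ← mul_assoc, ← mul_assoc, ← mul_assoc, (commute_incl_incl_braid a).eq]

theorem sandwichExp_mul_incl (a : YH d u n) (b : YH d u (n + 1)) :
    sandwichExp d u z w n (b * incl d u n a) = sandwichExp d u z w n b * incl d u n a := by
  rw [sandwichExp_apply, sandwichExp_apply, ← condExp_mul_incl, map_mul (incl d u _), mul_assoc,
    mul_assoc, mul_assoc, mul_assoc, (commute_incl_incl_braid a).eq]

theorem sandwichExp_frameIdem (k : ZMod d) :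
    sandwichExp d u z w n (frameIdem d u (n + 1) k n)
      = w k • 1 + ((u - 1) * (w k + z)) • frameIdem d u (n + 1) k n := by
  have incl_eq := incl_frameIdem (u := u) k n.lt_succ_self
  rw [sandwichExp_apply, incl_eq, braid_mul_frameIdem_mul_braid k (by omega), map_add, map_add,
    map_smul, map_smul, condExp_frameIdem, ← incl_eq, condExp_incl_mul_frameIdem,
    condExp_incl_mul_braid_mul_incl, frameIdem_mul_self, Algebra.algebraMap_eq_smul_one]
  module

theorem sandwichExp_braid :
    sandwichExp d u z w (n + 1) (braid d u (n + 2) n)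
      = z • (braid d u (n + 2) n * braid d u (n + 2) n) := by
  have incl_eq := incl_braid (d := d) (u := u) (show n + 1 < n + 2 by omega)
  rw [sandwichExp_apply, incl_eq, ← braid_mul_braid_mul_braid, ← incl_eq,
    condExp_incl_mul_braid_mul_incl]

theorem sandwichExp_incl_mul_braid_mul_incl (a b : YH d u (n + 1)) :
    sandwichExp d u z w (n + 1) (incl d u (n + 1) a * braid d u (n + 2) n * incl d u (n + 1) b)
      = z • (incl d u (n + 1) a * (braid d u (n + 2) n * braid d u (n + 2) n)
        * incl d u (n + 1) b) := by
  rw [sandwichExp_mul_incl, sandwichExp_incl_mul, sandwichExp_braid, mul_smul_comm, smul_mul_assoc]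

theorem jtrace_frameIdem_mul_sandwichExp_of_braid (k : ZMod d) (a b : YH d u (n + 1)) :
    jtrace d u z w (n + 2) (frameIdem d u (n + 2) k (n + 1) * sandwichExp d u z w (n + 1)
        (incl d u (n + 1) a * braid d u (n + 2) n * incl d u (n + 1) b))
      = jtrace d u z w (n + 2) (sandwichExp d u z w (n + 1) (frameIdem d u (n + 2) k (n + 1))
        * (incl d u (n + 1) a * braid d u (n + 2) n * incl d u (n + 1) b)) := by
  have idem_mul_sq : frameIdem d u (n + 2) k (n + 1)
      * (incl d u (n + 1) a * (braid d u (n + 2) n * braid d u (n + 2) n) * incl d u (n + 1) b)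
      = incl d u (n + 1) a * (braid d u (n + 2) n
        * incl d u (n + 1) (frameIdem d u (n + 1) k n) * braid d u (n + 2) n)
        * incl d u (n + 1) b := by
    rw [incl_frameIdem k n.lt_succ_self, braid_mul_frameIdem, ← mul_assoc, ← mul_assoc,
      ← (commute_incl_frameIdem a k).eq]
    simp only [mul_assoc]
  rw [sandwichExp_incl_mul_braid_mul_incl, sandwichExp_frameIdem, mul_smul_comm, idem_mul_sq,
    map_smul, jtrace_succ, condExp_mul_incl, condExp_incl_mul, ← sandwichExp_apply,
    sandwichExp_frameIdem, add_mul, smul_mul_assoc, smul_mul_assoc, one_mul,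
    frameIdem_mul_incl_mul_braid_mul_incl, map_add, map_smul, map_smul,
    jtrace_incl_mul_braid_mul_incl, jtrace_incl_mul_braid_mul_incl]
  simp only [mul_add, add_mul, mul_smul_comm, smul_mul_assoc, map_add, map_smul, mul_one,
    smul_eq_mul, mul_assoc]
  ring

theorem jtrace_frameIdem_mul_sandwichExp (k : ZMod d) (b : YH d u (n + 1)) :
    jtrace d u z w (n + 1) (frameIdem d u (n + 1) k n * sandwichExp d u z w n b)
      = jtrace d u z w (n + 1) (sandwichExp d u z w n (frameIdem d u (n + 1) k n) * b) := by
  induction b using induction_bimodule with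
  | hadd b b' hb hb' => simp only [map_add, mul_add, hb, hb']
  | hframe b l =>
    rw [sandwichExp_incl_mul, sandwichExp_frameIdem, sandwichExp_frameIdem, ← mul_assoc,
      ← (commute_incl_frameIdem b k).eq, mul_add, add_mul, mul_smul_comm, mul_smul_comm, mul_one,
      smul_mul_assoc, smul_mul_assoc, one_mul, ← mul_assoc (frameIdem _ _ _ _ _),
      ← (commute_incl_frameIdem b k).eq, mul_assoc, frameIdem_mul_frameIdem]
    simp only [map_add, map_smul, smul_eq_mul, jtrace_incl_mul_frameIdem]
    split_ifs with h
    · subst h; rfl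
    · simp [mul_left_comm]
  | hbraid m hm b c =>
    subst hm
    exact jtrace_frameIdem_mul_sandwichExp_of_braid z w k b c

theorem jtrace_tie_swap (b c : YH d u (n + 1)) :
    jtrace d u z w (n + 2) (braid d u (n + 2) n * incl d u (n + 1) b * tie d u (n + 2) n
        * incl d u (n + 1) c)
      = jtrace d u z w (n + 2) (tie d u (n + 2) n * incl d u (n + 1) b * braid d u (n + 2) n
        * incl d u (n + 1) c) := by
  simp only [tie_eq_sum, Finset.mul_sum, Finset.sum_mul, map_sum]
  refine Finset.sum_congr rfl fun k _ => ?_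
  have incl_eq := incl_frameIdem (u := u) k n.lt_succ_self
  have left_eq : braid d u (n + 2) n * incl d u (n + 1) b
      * (frameIdem d u (n + 2) k n * frameIdem d u (n + 2) k (n + 1)) * incl d u (n + 1) c
      = incl d u (n + 1) (1 * frameIdem d u (n + 1) k n) * braid d u (n + 2) n
        * incl d u (n + 1) (b * frameIdem d u (n + 1) k n * c) := by
    rw [← incl_mul_braid_mul_incl_mul_frameIdem, map_one, one_mul, mul_assoc _ _ (incl _ _ _ c),
      mul_assoc _ _ (incl _ _ _ c), ← (commute_incl_frameIdem c k).eq, map_mul, map_mul, incl_eq]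
    simp only [mul_assoc]
  have right_eq : frameIdem d u (n + 2) k n * frameIdem d u (n + 2) k (n + 1)
      * incl d u (n + 1) b * braid d u (n + 2) n * incl d u (n + 1) c
      = incl d u (n + 1) (frameIdem d u (n + 1) k n * b) * braid d u (n + 2) n
        * incl d u (n + 1) (frameIdem d u (n + 1) k n * c) := by
    rw [← frameIdem_mul_incl_mul_braid_mul_incl, map_mul, incl_eq,
      (commute_frameIdem k k n (n + 1)).eq]
    simp only [mul_assoc]
  rw [left_eq, right_eq, jtrace_incl_mul_braid_mul_incl, jtrace_incl_mul_braid_mul_incl, one_mul]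
  simp only [mul_assoc]

theorem jtrace_incl_mul_frameIdem_mul_sandwichExp
    (hcomm : ∀ a b : YH d u (n + 1),
      jtrace d u z w (n + 1) (a * b) = jtrace d u z w (n + 1) (b * a))
    (a : YH d u n) (k : ZMod d) (b : YH d u (n + 1)) :
    jtrace d u z w (n + 1)
        (incl d u n a * frameIdem d u (n + 1) k n * sandwichExp d u z w n b)
      = jtrace d u z w (n + 1)
        (sandwichExp d u z w n (incl d u n a * frameIdem d u (n + 1) k n) * b) := by
  rw [mul_assoc, hcomm, mul_assoc, ← sandwichExp_mul_incl, jtrace_frameIdem_mul_sandwichExp,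
    sandwichExp_incl_mul, mul_assoc, hcomm (incl _ _ _ _), mul_assoc]

section

variable (hcomm : ∀ a b : YH d u (n + 2),
  jtrace d u z w (n + 2) (a * b) = jtrace d u z w (n + 2) (b * a))
include hcomm

theorem jtrace_tie_mul_braid_swap (b c : YH d u (n + 1)) :
    jtrace d u z w (n + 2) (braid d u (n + 2) n * incl d u (n + 1) b
        * (tie d u (n + 2) n * braid d u (n + 2) n) * incl d u (n + 1) c)
      = jtrace d u z w (n + 2) (tie d u (n + 2) n * braid d u (n + 2) n * incl d u (n + 1) b
        * braid d u (n + 2) n * incl d u (n + 1) c) := by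
  simp only [tie_eq_sum, Finset.mul_sum, Finset.sum_mul, map_sum]
  refine Finset.sum_congr rfl fun k _ => ?_
  have hb := (commute_incl_frameIdem b k).eq
  have hc := (commute_incl_frameIdem c k).eq
  have hg := braid_mul_frameIdem (u := u) (n := n + 2) k n
  have hg' := braid_mul_frameIdem_succ (u := u) (n := n + 2) k n
  have hE := (commute_frameIdem (u := u) (n := n + 2) k k n (n + 1)).eq
  set g := braid d u (n + 2) n
  set E := frameIdem d u (n + 2) k n
  set E' := frameIdem d u (n + 2) k (n + 1)
  set b' := incl d u (n + 1) b
  set c' := incl d u (n + 1) c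
  calc jtrace d u z w (n + 2) (g * b' * (E * E' * g) * c')
      = jtrace d u z w (n + 2) (g * (b' * E') * (E * g) * c') := by
        rw [hE]; simp only [mul_assoc]
    _ = jtrace d u z w (n + 2) ((g * E') * b' * g * (E' * c')) := by
        rw [hb, ← hg']; simp only [mul_assoc]
    _ = jtrace d u z w (n + 2) (E * g * b' * g * c' * E') := by
        rw [hg', ← hc]; simp only [mul_assoc]
    _ = jtrace d u z w (n + 2) (E * E' * g * b' * g * c') := by
        rw [hcomm, hE]; simp only [mul_assoc]

theorem jtrace_braid_mul_self_swap (b c : YH d u (n + 1)) :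
    jtrace d u z w (n + 2) (braid d u (n + 2) n * incl d u (n + 1) b
        * (braid d u (n + 2) n * braid d u (n + 2) n) * incl d u (n + 1) c)
      = jtrace d u z w (n + 2) (braid d u (n + 2) n * braid d u (n + 2) n * incl d u (n + 1) b
        * braid d u (n + 2) n * incl d u (n + 1) c) := by
  have one_swap : jtrace d u z w (n + 2)
        (braid d u (n + 2) n * incl d u (n + 1) b * incl d u (n + 1) c)
      = jtrace d u z w (n + 2)
        (incl d u (n + 1) b * braid d u (n + 2) n * incl d u (n + 1) c) := by
    rw [jtrace_incl_mul_braid_mul_incl, mul_assoc, ← map_mul, ← one_mul (braid _ _ _ _),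
      ← map_one (incl d u (n + 1)), jtrace_incl_mul_braid_mul_incl, one_mul]
  rw [braid_mul_self (show n + 1 < n + 2 by omega)]
  simp only [mul_add, add_mul, mul_one, one_mul, mul_smul_comm, smul_mul_assoc, map_add, map_smul,
    one_swap, jtrace_tie_swap, jtrace_tie_mul_braid_swap z w hcomm]

theorem jtrace_braid_mul_sandwichExp (b : YH d u (n + 2)) :
    jtrace d u z w (n + 2) (braid d u (n + 2) n * sandwichExp d u z w (n + 1) b)
      = jtrace d u z w (n + 2) (sandwichExp d u z w (n + 1) (braid d u (n + 2) n) * b) := by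
  induction b using induction_bimodule with
  | hadd b b' hb hb' => simp only [map_add, mul_add, hb, hb']
  | hframe b l =>
    rw [hcomm, ← jtrace_incl_mul_frameIdem_mul_sandwichExp z w hcomm, hcomm]
  | hbraid m hm b c =>
    obtain rfl : m = n := by omega
    rw [sandwichExp_incl_mul_braid_mul_incl, sandwichExp_braid, mul_smul_comm, smul_mul_assoc,
      map_smul, map_smul, ← mul_assoc, ← mul_assoc, jtrace_braid_mul_self_swap z w hcomm]
    simp only [mul_assoc]

theorem jtrace_incl_mul_braid_mul_incl_mul_sandwichExp (a a' : YH d u (n + 1))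
    (b : YH d u (n + 2)) :
    jtrace d u z w (n + 2) (incl d u (n + 1) a * braid d u (n + 2) n * incl d u (n + 1) a'
        * sandwichExp d u z w (n + 1) b)
      = jtrace d u z w (n + 2) (sandwichExp d u z w (n + 1)
        (incl d u (n + 1) a * braid d u (n + 2) n * incl d u (n + 1) a') * b) := by
  have rotated := jtrace_braid_mul_sandwichExp z w hcomm
    (incl d u (n + 1) a' * b * incl d u (n + 1) a)
  rw [sandwichExp_mul_incl, sandwichExp_incl_mul, ← mul_assoc, hcomm,
    ← mul_assoc _ _ (incl _ _ _ a), hcomm _ (incl _ _ _ a)] at rotated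
  rw [sandwichExp_mul_incl, sandwichExp_incl_mul]
  simpa only [mul_assoc] using rotated

end

theorem jtrace_mul_sandwichExp
    (hcomm : ∀ a b : YH d u (n + 1),
      jtrace d u z w (n + 1) (a * b) = jtrace d u z w (n + 1) (b * a)) (a b : YH d u (n + 1)) :
    jtrace d u z w (n + 1) (a * sandwichExp d u z w n b)
      = jtrace d u z w (n + 1) (sandwichExp d u z w n a * b) := by
  induction a using induction_bimodule with
  | hadd a a' ha ha' => simp only [map_add, add_mul, ha, ha']
  | hframe a k => exact jtrace_incl_mul_frameIdem_mul_sandwichExp z w hcomm a k b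
  | hbraid m hm a a' =>
    subst hm
    exact jtrace_incl_mul_braid_mul_incl_mul_sandwichExp z w hcomm a a' b

theorem jtrace_mul_frameIdem_comm (k : ZMod d) (a : YH d u (n + 1)) :
    jtrace d u z w (n + 1) (a * frameIdem d u (n + 1) k n)
      = jtrace d u z w (n + 1) (frameIdem d u (n + 1) k n * a) := by
  induction a using induction_bimodule with
  | hadd a a' ha ha' => rw [add_mul, mul_add, map_add, map_add, ha, ha']
  | hframe a l =>
    rw [((commute_incl_frameIdem a k).mul_left (commute_frameIdem l k n n)).eq]
  | hbraid m hm a a' =>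
    subst hm
    rw [incl_mul_braid_mul_incl_mul_frameIdem, frameIdem_mul_incl_mul_braid_mul_incl,
      jtrace_incl_mul_braid_mul_incl, jtrace_incl_mul_braid_mul_incl, mul_assoc]

theorem jtrace_mul_braid_comm
    (hcomm : ∀ a b : YH d u (n + 1),
      jtrace d u z w (n + 1) (a * b) = jtrace d u z w (n + 1) (b * a)) (a : YH d u (n + 2)) :
    jtrace d u z w (n + 2) (a * braid d u (n + 2) n)
      = jtrace d u z w (n + 2) (braid d u (n + 2) n * a) := by
  induction a using induction_bimodule with
  | hadd a a' ha ha' => rw [add_mul, mul_add, map_add, map_add, ha, ha']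
  | hframe a k =>
    have right_eq := frameIdem_mul_incl_mul_braid_mul_incl k a (1 : YH d u (n + 1))
    have left_eq := incl_mul_braid_mul_incl_mul_frameIdem k (1 : YH d u (n + 1)) a
    rw [map_one, mul_one, mul_one] at right_eq
    rw [map_one, one_mul, one_mul] at left_eq
    rw [← mul_assoc, left_eq, (commute_incl_frameIdem a k).eq, mul_assoc, right_eq,
      jtrace_incl_mul_braid_mul_incl, jtrace_incl_mul_braid_mul_incl, hcomm]
  | hbraid m hm a a' =>
    obtain rfl : m = n := by omega
    have swap := jtrace_mul_sandwichExp z w hcomm a a'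
    rw [sandwichExp_apply, sandwichExp_apply, ← condExp_incl_mul, ← condExp_mul_incl,
      ← jtrace_succ, ← jtrace_succ] at swap
    simpa only [mul_assoc] using swap

theorem jtrace_comm (n : ℕ) (a b : YH d u n) :
    jtrace d u z w n (a * b) = jtrace d u z w n (b * a) := by
  induction n with
  | zero => simp [jtrace, mul_comm]
  | succ n ih =>
    have incl_comm (c : YH d u n) (a : YH d u (n + 1)) :
        jtrace d u z w (n + 1) (a * incl d u n c) = jtrace d u z w (n + 1) (incl d u n c * a) := by
      rw [jtrace_succ, jtrace_succ, condExp_incl_mul, condExp_mul_incl, ih]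
    induction b using induction_bimodule with
    | hadd b b' hb hb' => rw [mul_add, add_mul, map_add, map_add, hb, hb']
    | hframe c k =>
      rw [← mul_assoc, jtrace_mul_frameIdem_comm, ← mul_assoc, incl_comm, mul_assoc]
    | hbraid m hm c c' =>
      subst hm
      rw [← mul_assoc, incl_comm, ← mul_assoc, ← mul_assoc, jtrace_mul_braid_comm z w ih,
        ← mul_assoc, ← mul_assoc, incl_comm, ← mul_assoc, ← mul_assoc]

end YH

end Trace

section Juyumaya

variable {d : ℕ} [NeZero d] {u z : ℂ} {x : ZMod d → ℂ}

/-- The number `y_k / d`, which is the value of the Juyumaya trace with parameters `z` and `x_m` on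
the idempotents `E_k(t_j)`. -/
noncomputable def frameWeight (x : ZMod d → ℂ) (k : ZMod d) : ℂ := (1 / (d : ℂ)) * ZMod.dft x k

theorem dft_eq_mul_frameWeight (x : ZMod d → ℂ) (k : ZMod d) :
    ZMod.dft x k = d * frameWeight x k := by
  rw [frameWeight, ← mul_assoc, mul_one_div_cancel (NeZero.ne _), one_mul]

theorem frameWeight_eq_iff {v : ZMod d → ℂ} :
    (∀ k, frameWeight x k = v k) ↔ ∀ m, x m = ∑ k, ZMod.stdAddChar (k * m) * v k := by
  have dft_eq_iff : (∀ k, frameWeight x k = v k) ↔ ZMod.dft x = fun k => d * v k := by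
    simp only [funext_iff, dft_eq_mul_frameWeight, mul_right_inj' (NeZero.ne (d : ℂ))]
  have invDFT_eq (m : ZMod d) : ZMod.dft.symm (fun k => d * v k) m
      = ∑ k, ZMod.stdAddChar (k * m) * v k := by
    rw [ZMod.invDFT_apply, Finset.smul_sum]
    refine Finset.sum_congr rfl fun k _ => ?_
    rw [smul_eq_mul, smul_eq_mul, mul_left_comm, inv_mul_cancel_left₀ (NeZero.ne _)]
  rw [dft_eq_iff, ← LinearEquiv.eq_symm_apply, funext_iff]
  simp only [invDFT_eq]

theorem eq_sum_mul_frameWeight (x : ZMod d → ℂ) (m : ZMod d) :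
    x m = ∑ k, ZMod.stdAddChar (k * m) * frameWeight x k :=
  frameWeight_eq_iff.mp (fun _ => rfl) m

theorem frameWeight_eq_sum (x : ZMod d → ℂ) (k : ZMod d) :
    frameWeight x k = (1 / (d : ℂ)) * ∑ m, ZMod.stdAddChar (-(m * k)) * x m := by
  rw [frameWeight, ZMod.dft_apply]
  rfl

theorem sum_frameWeight (x : ZMod d → ℂ) : ∑ k, frameWeight x k = x 0 := by
  simp [eq_sum_mul_frameWeight x 0]

namespace YH

theorem isJuyumayaTrace_jtrace (hx : x 0 = 1) :
    IsJuyumayaTrace d u z x (jtrace d u z (frameWeight x)) where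
  compat n a := by
    rw [← mul_one (incl d u n a), ← sum_frameIdem n, Finset.mul_sum, map_sum]
    simp only [jtrace_incl_mul_frameIdem]
    rw [← Finset.sum_mul, sum_frameWeight, hx, one_mul]
  one n := by
    induction n with
    | zero => simp [jtrace]
    | succ n ih =>
      rw [jtrace_succ, ← sum_frameIdem n, map_sum]
      simp only [condExp_frameIdem]
      rw [← map_sum, sum_frameWeight, hx, map_one, ih]
  comm := jtrace_comm z _
  markov n a := by
    have jtrace_eq := jtrace_incl_mul_braid_mul_incl z (frameWeight x) a 1
    rwa [map_one, mul_one, mul_one, ← g_eq_braid (by omega)] at jtrace_eq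
  frame n a m _ _ := by
    rw [t_eq_frame, pow_eq_sum_eigenIdem (frame_pow_card n), Finset.mul_sum, map_sum,
      eq_sum_mul_frameWeight x m, Finset.sum_mul]
    refine Finset.sum_congr rfl fun k _ => ?_
    rw [mul_smul_comm, map_smul, ← frameIdem, jtrace_incl_mul_frameIdem, smul_eq_mul, mul_assoc]

omit [NeZero d] in
theorem algebraMap_surjective : Function.Surjective (algebraMap ℂ (YH d u 0)) := by
  intro a
  induction a using YH.induction with
  | hc c => exact ⟨c, rfl⟩
  | hadd a b ha hb =>
    obtain ⟨c, rfl⟩ := ha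
    obtain ⟨c', rfl⟩ := hb
    exact ⟨c + c', map_add _ _ _⟩
  | hmul a b ha hb =>
    obtain ⟨c, rfl⟩ := ha
    obtain ⟨c', rfl⟩ := hb
    exact ⟨c * c', map_mul _ _ _⟩
  | hg i hi => omega
  | ht j hj => omega

end YH

namespace IsJuyumayaTrace

open YH

variable {tr tr' : ∀ n : ℕ, YH d u n →ₗ[ℂ] ℂ} {n : ℕ}

theorem map_incl_mul_frame_pow (h : IsJuyumayaTrace d u z x tr) (hx : x 0 = 1) (a : YH d u n)
    (m : ZMod d) : tr (n + 1) (incl d u n a * YH.frame d u (n + 1) n ^ m.val) = x m * tr n a := by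
  by_cases hm : m = 0
  · rw [hm, ZMod.val_zero, pow_zero, mul_one, h.compat, hx, one_mul]
  · have val_ne_zero := (ZMod.val_ne_zero m).mpr hm
    have val_lt := ZMod.val_lt m
    have frame_eq := h.frame n a m.val (by omega) (by omega)
    rwa [t_eq_frame, ZMod.natCast_zmod_val] at frame_eq

theorem map_incl_mul_frameIdem (h : IsJuyumayaTrace d u z x tr) (hx : x 0 = 1) (a : YH d u n)
    (k : ZMod d) :
    tr (n + 1) (incl d u n a * frameIdem d u (n + 1) k n) = frameWeight x k * tr n a := by
  rw [frameIdem, eigenIdem, frameWeight_eq_sum]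
  simp only [mul_smul_comm, Finset.mul_sum, map_smul, map_sum, h.map_incl_mul_frame_pow hx,
    smul_eq_mul, Finset.sum_mul, mul_assoc]

omit [NeZero d] in
theorem map_incl_mul_braid_mul_incl (h : IsJuyumayaTrace d u z x tr) (a b : YH d u (n + 1)) :
    tr (n + 2) (incl d u (n + 1) a * braid d u (n + 2) n * incl d u (n + 1) b)
      = z * tr (n + 1) (a * b) := by
  rw [h.comm, ← mul_assoc, ← map_mul, ← g_eq_braid (by omega), h.markov, h.comm]

protected theorem unique (h : IsJuyumayaTrace d u z x tr) (h' : IsJuyumayaTrace d u z x tr')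
    (hx : x 0 = 1) : tr = tr' := by
  funext n
  ext a
  induction n with
  | zero =>
    obtain ⟨c, rfl⟩ := algebraMap_surjective a
    rw [Algebra.algebraMap_eq_smul_one, map_smul, map_smul, h.one, h'.one]
  | succ n ih =>
    induction a using induction_bimodule with
    | hadd a b ha hb => rw [map_add, map_add, ha, hb]
    | hframe a k => rw [h.map_incl_mul_frameIdem hx, h'.map_incl_mul_frameIdem hx, ih]
    | hbraid m hm a b =>
      subst hm
      rw [h.map_incl_mul_braid_mul_incl, h'.map_incl_mul_braid_mul_incl, ih]

end IsJuyumayaTrace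

theorem existsUnique_isJuyumayaTrace (u z : ℂ) (hx : x 0 = 1) :
    ∃! tr : ∀ n : ℕ, YH d u n →ₗ[ℂ] ℂ, IsJuyumayaTrace d u z x tr :=
  ⟨_, YH.isJuyumayaTrace_jtrace hx, fun _ h => h.unique (YH.isJuyumayaTrace_jtrace hx) hx⟩

end Juyumaya

section Quotient

namespace YH

variable {d : ℕ} {u : ℂ} {n : ℕ}

/-- The element `g_{i,i+1}`, extended to all indices `i`. -/
noncomputable def braidSum (d : ℕ) (u : ℂ) (n i : ℕ) : YH d u n :=
  braid d u n i * braid d u n (i + 1) * braid d u n i + braid d u n (i + 1) * braid d u n i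
    + braid d u n i * braid d u n (i + 1) + braid d u n i + braid d u n (i + 1) + 1

/-- The element `r_{i,i+1} = e_i e_{i+1} g_{i,i+1}`, extended to all indices `i`. -/
noncomputable def ftlGen (d : ℕ) (u : ℂ) (n i : ℕ) : YH d u n :=
  tie d u n i * tie d u n (i + 1) * braidSum d u n i

theorem r_eq_ftlGen {i : ℕ} (h : i + 2 < n) : r d u i h = ftlGen d u n i := by
  simp only [r, gg, ftlGen, braidSum, e_eq_tie, g_eq_braid]

theorem braidSum_eq (i : ℕ) :
    braidSum d u n i
      = (1 + braid d u n i) + (1 + braid d u n i) * braid d u n (i + 1) * (1 + braid d u n i) := by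
  rw [braidSum]; noncomm_ring

theorem braidSum_eq_succ (i : ℕ) :
    braidSum d u n i = (1 + braid d u n (i + 1))
      + (1 + braid d u n (i + 1)) * braid d u n i * (1 + braid d u n (i + 1)) := by
  rw [braidSum, braid_mul_braid_mul_braid]; noncomm_ring

theorem incl_braidSum {i : ℕ} (h : i + 2 < n) :
    incl d u n (braidSum d u n i) = braidSum d u (n + 1) i := by
  simp only [braidSum, map_add, map_mul, map_one, incl_braid (show i + 1 < n by omega),
    incl_braid (show i + 1 + 1 < n by omega)]

theorem incl_ftlGen {i : ℕ} (h : i + 2 < n) :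
    incl d u n (ftlGen d u n i) = ftlGen d u (n + 1) i := by
  simp only [ftlGen, map_mul, incl_braidSum h, incl_tie (show i + 1 < n by omega),
    incl_tie (show i + 1 + 1 < n by omega)]

theorem mul_braid_mul_one_add_braid {i : ℕ} (h : i + 1 < n) {q : YH d u n}
    (hq : q * tie d u n i = q) :
    q * (braid d u n i * (1 + braid d u n i)) = u • (q * (1 + braid d u n i)) := by
  rw [mul_add, mul_one, braid_mul_self h]
  simp only [mul_add, mul_one, mul_smul_comm, ← mul_assoc, hq]
  module

theorem braid_mul_mul_one_add_braid_mul {i : ℕ} (h : i + 1 < n) {q : YH d u n}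
    (hcomm : Commute (braid d u n i) q) (hq : q * tie d u n i = q) (y : YH d u n) :
    braid d u n i * (q * ((1 + braid d u n i) * y)) = u • (q * ((1 + braid d u n i) * y)) := by
  rw [← mul_assoc, hcomm.eq, mul_assoc, ← mul_assoc (braid _ _ _ _), ← mul_assoc,
    mul_braid_mul_one_add_braid h hq, smul_mul_assoc, mul_assoc]

theorem mul_one_add_braid_mul_self {i : ℕ} (h : i + 1 < n) {q : YH d u n}
    (hq : q * tie d u n i = q) :
    q * (1 + braid d u n i) * (1 + braid d u n i) = (u + 1) • (q * (1 + braid d u n i)) := by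
  rw [mul_assoc, add_mul 1, one_mul, mul_add, mul_braid_mul_one_add_braid h hq, add_smul, one_smul,
    add_comm]

/-- The element `g_i g_{i+1} g_{i+2}`, which conjugates `r_{i,i+1}` to `r_{i+1,i+2}`. -/
noncomputable def shift (d : ℕ) (u : ℂ) (n i : ℕ) : YH d u n :=
  braid d u n i * braid d u n (i + 1) * braid d u n (i + 2)

theorem semiconjBy_shift_braid (i : ℕ) :
    SemiconjBy (shift d u n i) (braid d u n i) (braid d u n (i + 1)) := by
  rw [SemiconjBy, shift, mul_assoc, ← (commute_braid (Or.inl (show i + 1 < i + 2 by omega))).eq,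
    ← mul_assoc, braid_mul_braid_mul_braid]
  simp only [mul_assoc]

theorem semiconjBy_shift_braid_succ (i : ℕ) :
    SemiconjBy (shift d u n i) (braid d u n (i + 1)) (braid d u n (i + 2)) := by
  rw [SemiconjBy, shift, mul_assoc, mul_assoc, ← mul_assoc (braid _ _ _ (i + 1)),
    braid_mul_braid_mul_braid (i + 1)]
  simp only [← mul_assoc]
  rw [(commute_braid (Or.inl (show i + 1 < i + 2 by omega))).eq]

theorem semiconjBy_shift_frame {i j : ℕ} (h : i ≤ j) (h' : j ≤ i + 2) :
    SemiconjBy (shift d u n i) (frame d u n j) (frame d u n (j + 1)) := by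
  have moved (a : ℕ) : SemiconjBy (braid d u n a) (frame d u n a) (frame d u n (a + 1)) :=
    (frame_succ_mul_braid a).symm
  have fixed {a b : ℕ} (h : b ≠ a) (h' : b ≠ a + 1) :
      SemiconjBy (braid d u n a) (frame d u n b) (frame d u n b) := (commute_frame_braid h h').symm
  obtain rfl | rfl | rfl : j = i ∨ j = i + 1 ∨ j = i + 2 := by omega
  · exact ((moved j).mul_left (fixed (by omega) (by omega))).mul_left (fixed (by omega) (by omega))
  · exact ((fixed (by omega) (by omega)).mul_left (moved (i + 1))).mul_left
      (fixed (by omega) (by omega))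
  · exact ((fixed (by omega) (by omega)).mul_left (fixed (by omega) (by omega))).mul_left
      (moved (i + 2))

theorem semiconjBy_shift_tie {i j : ℕ} (h : i ≤ j) (h' : j ≤ i + 1) :
    SemiconjBy (shift d u n i) (tie d u n j) (tie d u n (j + 1)) :=
  semiconjBy_yhE (semiconjBy_shift_frame h (by omega))
    (semiconjBy_shift_frame (by omega) (by omega))

theorem semiconjBy_shift_braidSum (i : ℕ) :
    SemiconjBy (shift d u n i) (braidSum d u n i) (braidSum d u n (i + 1)) := by
  have hg := semiconjBy_shift_braid (d := d) (u := u) (n := n) i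
  have hg' := semiconjBy_shift_braid_succ (d := d) (u := u) (n := n) i
  exact ((((((hg.mul_right hg').mul_right hg).add_right (hg'.mul_right hg)).add_right
    (hg.mul_right hg')).add_right hg).add_right hg').add_right (SemiconjBy.one_right _)

theorem semiconjBy_shift_ftlGen (i : ℕ) :
    SemiconjBy (shift d u n i) (ftlGen d u n i) (ftlGen d u n (i + 1)) :=
  ((semiconjBy_shift_tie le_rfl (by omega)).mul_right
    (semiconjBy_shift_tie (by omega) le_rfl)).mul_right (semiconjBy_shift_braidSum i)

variable [NeZero d]

theorem isUnit_braid (hu : u ≠ 0) {i : ℕ} (h : i + 1 < n) : IsUnit (braid d u n i) := by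
  set y := braid d u n i - ((u - 1) / u) • (tie d u n i * (1 + braid d u n i)) with hy
  have braid_comm_y : Commute (braid d u n i) y :=
    (Commute.refl _).sub_right (((commute_braid_tie i).mul_right
      ((Commute.one_right _).add_right (Commute.refl _))).smul_right _)
  have braid_mul_y : braid d u n i * y = 1 := by
    rw [hy, mul_sub, mul_smul_comm, ← mul_assoc, (commute_braid_tie i).eq, mul_assoc,
      mul_braid_mul_one_add_braid h (tie_mul_self i), smul_smul, div_mul_cancel₀ _ hu, mul_add,
      mul_one, braid_mul_self h]
    module
  exact (braid_comm_y.isUnit_mul_iff.mp (braid_mul_y ▸ isUnit_one)).1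

theorem isUnit_shift (hu : u ≠ 0) {i : ℕ} (h : i + 3 < n) : IsUnit (shift d u n i) :=
  ((isUnit_braid hu (by omega)).mul (isUnit_braid hu (by omega))).mul (isUnit_braid hu h)

/-- The element `E_k(t_i) E_k(t_{i+1}) E_k(t_{i+2})`. -/
noncomputable def tripleIdem (d : ℕ) [NeZero d] (u : ℂ) (n : ℕ) (k : ZMod d) (i : ℕ) : YH d u n :=
  frameIdem d u n k i * frameIdem d u n k (i + 1) * frameIdem d u n k (i + 2)

theorem frameIdem_mul_tie_mul_tie (k : ZMod d) (i : ℕ) :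
    frameIdem d u n k i * (tie d u n i * tie d u n (i + 1)) = tripleIdem d u n k i := by
  rw [← mul_assoc, frameIdem_mul_tie, mul_assoc, frameIdem_mul_tie, tripleIdem, mul_assoc]

theorem frameIdem_mul_ftlGen (k : ZMod d) (i : ℕ) :
    frameIdem d u n k i * ftlGen d u n i = tripleIdem d u n k i * braidSum d u n i := by
  rw [ftlGen, ← mul_assoc, frameIdem_mul_tie_mul_tie]

theorem ftlGen_eq_sum (i : ℕ) :
    ftlGen d u n i = ∑ k : ZMod d, tripleIdem d u n k i * braidSum d u n i := by
  rw [← one_mul (ftlGen d u n i), ← sum_frameIdem i, Finset.sum_mul]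
  exact Finset.sum_congr rfl fun k _ => frameIdem_mul_ftlGen k i

theorem incl_tripleIdem (k : ZMod d) {i : ℕ} (h : i + 2 < n) :
    incl d u n (tripleIdem d u n k i) = tripleIdem d u (n + 1) k i := by
  simp only [tripleIdem, map_mul, incl_frameIdem k h, incl_frameIdem k (show i < n by omega),
    incl_frameIdem k (show i + 1 < n by omega)]

theorem tripleIdem_eq_mul (k : ZMod d) (i : ℕ) :
    tripleIdem d u n k i
      = frameIdem d u n k (i + 2) * (frameIdem d u n k i * frameIdem d u n k (i + 1)) :=
  ((commute_frameIdem k k _ _).mul_left (commute_frameIdem k k _ _)).eq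

theorem tripleIdem_mul_tie (k : ZMod d) (i : ℕ) :
    tripleIdem d u n k i * tie d u n i = tripleIdem d u n k i := by
  rw [tripleIdem_eq_mul, mul_assoc, frameIdem_mul_frameIdem_succ_mul_tie]

theorem tripleIdem_mul_tie_succ (k : ZMod d) (i : ℕ) :
    tripleIdem d u n k i * tie d u n (i + 1) = tripleIdem d u n k i := by
  rw [tripleIdem, mul_assoc (frameIdem _ _ _ _ i), mul_assoc, frameIdem_mul_frameIdem_succ_mul_tie]

theorem commute_braid_tripleIdem (k : ZMod d) (i : ℕ) :
    Commute (braid d u n i) (tripleIdem d u n k i) :=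
  (commute_braid_frameIdem_mul_frameIdem_succ k i).mul_right
    (commute_braid_frameIdem k (by omega) (by omega))

theorem commute_braid_succ_tripleIdem (k : ZMod d) (i : ℕ) :
    Commute (braid d u n (i + 1)) (tripleIdem d u n k i) := by
  rw [tripleIdem, mul_assoc]
  exact (commute_braid_frameIdem k (by omega) (by omega)).mul_right
    (commute_braid_frameIdem_mul_frameIdem_succ k (i + 1))

theorem braid_mul_tripleIdem_mul_braidSum (k : ZMod d) {i : ℕ} (h : i + 1 < n) :
    braid d u n i * (tripleIdem d u n k i * braidSum d u n i)
      = u • (tripleIdem d u n k i * braidSum d u n i) := by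
  have factor : braidSum d u n i
      = (1 + braid d u n i) * (1 + braid d u n (i + 1) * (1 + braid d u n i)) := by
    rw [braidSum_eq]; noncomm_ring
  rw [factor]
  exact braid_mul_mul_one_add_braid_mul h (commute_braid_tripleIdem k i) (tripleIdem_mul_tie k i) _

theorem braid_succ_mul_tripleIdem_mul_braidSum (k : ZMod d) {i : ℕ} (h : i + 2 < n) :
    braid d u n (i + 1) * (tripleIdem d u n k i * braidSum d u n i)
      = u • (tripleIdem d u n k i * braidSum d u n i) := by
  have factor : braidSum d u n i
      = (1 + braid d u n (i + 1)) * (1 + braid d u n i * (1 + braid d u n (i + 1))) := by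
    rw [braidSum_eq_succ]; noncomm_ring
  rw [factor]
  exact braid_mul_mul_one_add_braid_mul h (commute_braid_succ_tripleIdem k i)
    (tripleIdem_mul_tie_succ k i) _

theorem tripleIdem_mul_braidSum_eq (k : ZMod d) (i : ℕ) :
    tripleIdem d u n k i * braidSum d u n i
      = frameIdem d u n k i * frameIdem d u n k (i + 1) * (1 + braid d u n i)
          * frameIdem d u n k (i + 2)
        + frameIdem d u n k i * frameIdem d u n k (i + 1) * (1 + braid d u n i)
          * frameIdem d u n k (i + 2) * braid d u n (i + 1) * (1 + braid d u n i) := by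
  have one_add_braid_comm : Commute (1 + braid d u n i) (frameIdem d u n k (i + 2)) :=
    (Commute.one_left _).add_left (commute_braid_frameIdem k (by omega) (by omega))
  rw [tripleIdem, braidSum_eq]
  generalize 1 + braid d u n i = s at *
  simp only [mul_assoc _ s (frameIdem d u n k (i + 2)), one_add_braid_comm.eq, mul_add, mul_assoc]

theorem frame_mul_tripleIdem (k : ZMod d) {i j : ℕ} (h : i ≤ j) (h' : j ≤ i + 2) :
    frame d u n j * tripleIdem d u n k i = (ZMod.stdAddChar k : ℂ) • tripleIdem d u n k i := by
  suffices ∃ q, tripleIdem d u n k i = frameIdem d u n k j * q by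
    obtain ⟨q, hq⟩ := this
    rw [hq, ← mul_assoc, frame_mul_frameIdem, smul_mul_assoc]
  obtain rfl | rfl | rfl : j = i ∨ j = i + 1 ∨ j = i + 2 := by omega
  · exact ⟨_, mul_assoc _ _ _⟩
  · exact ⟨_, by rw [tripleIdem, (commute_frameIdem k k i (i + 1)).eq, mul_assoc]⟩
  · exact ⟨_, tripleIdem_eq_mul k i⟩

theorem exists_mul_eq_smul (k : ZMod d) (b : YH d u 3) :
    ∃ c : ℂ, b * (tripleIdem d u 3 k 0 * braidSum d u 3 0)
      = c • (tripleIdem d u 3 k 0 * braidSum d u 3 0) := by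
  induction b using induction with
  | hc c => exact ⟨c, by rw [← Algebra.smul_def]⟩
  | hadd a b ha hb =>
    obtain ⟨c, hc⟩ := ha
    obtain ⟨c', hc'⟩ := hb
    exact ⟨c + c', by rw [add_mul, hc, hc', add_smul]⟩
  | hmul a b ha hb =>
    obtain ⟨c, hc⟩ := ha
    obtain ⟨c', hc'⟩ := hb
    exact ⟨c' * c, by rw [mul_assoc, hc', mul_smul_comm, hc, smul_smul]⟩
  | hg i hi =>
    obtain rfl | rfl : i = 0 ∨ i = 1 := by omega
    · exact ⟨u, braid_mul_tripleIdem_mul_braidSum k (by omega)⟩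
    · exact ⟨u, braid_succ_mul_tripleIdem_mul_braidSum k (by omega)⟩
  | ht j hj =>
    exact ⟨_, by rw [← mul_assoc, frame_mul_tripleIdem k (by omega) (by omega), smul_mul_assoc]⟩

end YH

open YH

section Factorization

variable {d : ℕ} {u : ℂ} {n : ℕ} {τ : YH d u n →ₗ[ℂ] ℂ}

theorem ftlIdeal_mk_eq_zero_iff {a : YH d u n} :
    (ftlIdeal d u n).ringCon.mkₐ ℂ a = 0 ↔ a ∈ ftlIdeal d u n := by
  rw [TwoSidedIdeal.mem_iff, ← RingCon.eq]
  rfl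

theorem passesToFTL_iff_forall_mem : PassesToFTL τ ↔ ∀ a ∈ ftlIdeal d u n, τ a = 0 := by
  constructor
  · rintro ⟨σ, hσ⟩ a ha
    rw [← hσ, ftlIdeal_mk_eq_zero_iff.mpr ha, map_zero]
  · intro hτ
    let q : YH d u n →ₗ[ℂ] FTL d u n := ((ftlIdeal d u n).ringCon.mkₐ ℂ).toLinearMap
    have q_surjective : Function.Surjective q := RingCon.mk'_surjective _
    obtain ⟨s, hs⟩ := q.exists_rightInverse_of_surjective (LinearMap.range_eq_top.mpr q_surjective)
    refine ⟨τ ∘ₗ s, fun a => ?_⟩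
    have q_sub : q (s (q a) - a) = 0 := by
      rw [map_sub, sub_eq_zero]; exact LinearMap.congr_fun hs (q a)
    rw [← sub_eq_zero]
    exact (map_sub τ _ _).symm.trans (hτ _ (ftlIdeal_mk_eq_zero_iff.mp q_sub))

theorem passesToFTL_iff_map_mul_ftlGen (hcomm : ∀ a b, τ (a * b) = τ (b * a)) :
    PassesToFTL τ ↔ ∀ i, i + 2 < n → ∀ b, τ (b * ftlGen d u n i) = 0 := by
  rw [passesToFTL_iff_forall_mem]
  constructor
  · intro hτ i hi b
    exact hτ _ (TwoSidedIdeal.mul_mem_left _ _ _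
      (TwoSidedIdeal.subset_span ⟨i, hi, (r_eq_ftlGen hi).symm⟩))
  · intro hτ
    suffices ∀ a ∈ ftlIdeal d u n, ∀ b, τ (b * a) = 0 from fun a ha => by simpa using this a ha 1
    intro a ha
    induction ha using TwoSidedIdeal.span_induction with
    | mem a ha =>
      obtain ⟨i, hi, rfl⟩ := ha
      rw [r_eq_ftlGen hi]
      exact hτ i hi
    | zero => simp
    | add a a' _ _ h h' => intro b; rw [mul_add, map_add, h, h', add_zero]
    | neg a _ h => exact fun b => (congrArg τ (mul_neg b _)).trans (by rw [map_neg, h, neg_zero])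
    | left_absorb c a _ h => intro b; rw [← mul_assoc, h]
    | right_absorb c a _ h => intro b; rw [← mul_assoc, hcomm, ← mul_assoc, h]

end Factorization

namespace IsJuyumayaTrace

variable {d : ℕ} [NeZero d] {u z : ℂ} {x : ZMod d → ℂ} {tr : ∀ n : ℕ, YH d u n →ₗ[ℂ] ℂ} {n : ℕ}

theorem map_mul_ftlGen_zero (h : IsJuyumayaTrace d u z x tr) (hx : x 0 = 1)
    (hvanish : ∀ k, tr 3 (tripleIdem d u 3 k 0 * braidSum d u 3 0) = 0) (hn : 3 ≤ n)
    (b : YH d u n) : tr n (b * ftlGen d u n 0) = 0 := by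
  induction n, hn using Nat.le_induction with
  | base =>
    rw [ftlGen_eq_sum, Finset.mul_sum, map_sum]
    refine Finset.sum_eq_zero fun k _ => ?_
    obtain ⟨c, hc⟩ := exists_mul_eq_smul k b
    rw [hc, map_smul, hvanish, smul_zero]
  | succ n hn ih =>
    rw [← incl_ftlGen (by omega)]
    induction b using induction_bimodule with
    | hadd a b ha hb => rw [add_mul, map_add, ha, hb, add_zero]
    | hframe b k =>
      rw [mul_assoc, ← (commute_incl_frameIdem _ k).eq, ← mul_assoc, ← map_mul,
        h.map_incl_mul_frameIdem hx, ih, mul_zero]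
    | hbraid m hm b c =>
      subst hm
      rw [mul_assoc, ← map_mul, h.map_incl_mul_braid_mul_incl, ← mul_assoc, ih, mul_zero]

theorem map_mul_ftlGen (h : IsJuyumayaTrace d u z x tr) (hx : x 0 = 1) (hu : u ≠ 0)
    (hvanish : ∀ k, tr 3 (tripleIdem d u 3 k 0 * braidSum d u 3 0) = 0) {i : ℕ}
    (hi : i + 2 < n) (b : YH d u n) : tr n (b * ftlGen d u n i) = 0 := by
  induction i generalizing b with
  | zero => exact h.map_mul_ftlGen_zero hx hvanish (by omega) b
  | succ i ih =>
    obtain ⟨s, hs⟩ := isUnit_shift (d := d) hu (show i + 3 < n by omega)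
    have conj : ftlGen d u n (i + 1) = s * ftlGen d u n i * (↑s⁻¹ : YH d u n) := by
      rw [Units.eq_mul_inv_iff_mul_eq, hs, (semiconjBy_shift_ftlGen i).eq]
    rw [conj, ← mul_assoc, h.comm, ← mul_assoc, ← mul_assoc]
    exact ih (by omega) _

theorem map_tripleIdem_mul_braidSum_of_le (h : IsJuyumayaTrace d u z x tr) (k : ZMod d)
    (hn : 3 ≤ n) :
    tr n (tripleIdem d u n k 0 * braidSum d u n 0)
      = tr 3 (tripleIdem d u 3 k 0 * braidSum d u 3 0) := by
  induction n, hn using Nat.le_induction with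
  | base => rfl
  | succ n hn ih =>
    rw [← incl_tripleIdem k (by omega), ← incl_braidSum (by omega), ← map_mul, h.compat, ih]

theorem map_frameIdem (h : IsJuyumayaTrace d u z x tr) (hx : x 0 = 1) (k : ZMod d) (n : ℕ) :
    tr (n + 1) (frameIdem d u (n + 1) k n) = frameWeight x k := by
  have map_eq := h.map_incl_mul_frameIdem hx (1 : YH d u n) k
  rwa [map_one, one_mul, h.one, mul_one] at map_eq

theorem map_incl_mul_frameIdem_mul_braid_mul_incl (h : IsJuyumayaTrace d u z x tr) (k : ZMod d)
    (a b : YH d u (n + 1)) :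
    tr (n + 2) (incl d u (n + 1) a * frameIdem d u (n + 2) k (n + 1) * braid d u (n + 2) n
        * incl d u (n + 1) b)
      = z * tr (n + 1) (a * frameIdem d u (n + 1) k n * b) := by
  rw [mul_assoc (incl _ _ _ a), ← braid_mul_frameIdem, ← incl_frameIdem k n.lt_succ_self,
    mul_assoc, mul_assoc, ← map_mul, ← mul_assoc, h.map_incl_mul_braid_mul_incl, mul_assoc]

theorem map_frameIdem_mul_frameIdem_mul_one_add_braid (h : IsJuyumayaTrace d u z x tr)
    (hx : x 0 = 1) (k : ZMod d) :
    tr 2 (frameIdem d u 2 k 0 * frameIdem d u 2 k 1 * (1 + braid d u 2 0))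
      = frameWeight x k * (frameWeight x k + z) := by
  have incl_eq := incl_frameIdem (u := u) k Nat.zero_lt_one
  have map_braid := h.map_incl_mul_frameIdem_mul_braid_mul_incl k (frameIdem d u 1 k 0) 1
  rw [incl_eq, map_one, mul_one, mul_one, frameIdem_mul_self, h.map_frameIdem hx] at map_braid
  rw [mul_add, mul_one, map_add, map_braid, ← incl_eq, h.map_incl_mul_frameIdem hx,
    h.map_frameIdem hx]
  ring

theorem map_tripleIdem_mul_braidSum (h : IsJuyumayaTrace d u z x tr) (hx : x 0 = 1) (k : ZMod d) :
    tr 3 (tripleIdem d u 3 k 0 * braidSum d u 3 0)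
      = frameWeight x k * (frameWeight x k + z) * (frameWeight x k + (u + 1) * z) := by
  have map_pair := h.map_frameIdem_mul_frameIdem_mul_one_add_braid hx k
  have pair_comm := commute_braid_frameIdem_mul_frameIdem_succ (u := u) (n := 2) k 0
  have pair_mul_sq := mul_one_add_braid_mul_self (n := 2) (by omega)
    (frameIdem_mul_frameIdem_succ_mul_tie (u := u) k 0)
  set p := frameIdem d u 2 k 0 * frameIdem d u 2 k 1 with hp
  set s := 1 + braid d u 2 0 with hs
  have pair_mul_idem : p * s * frameIdem d u 2 k 1 = p * s := by
    rw [← ((Commute.one_left p).add_left pair_comm).eq, mul_assoc, hp, mul_assoc,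
      frameIdem_mul_self]
  have expand : tripleIdem d u 3 k 0 * braidSum d u 3 0
      = incl d u 2 (p * s) * frameIdem d u 3 k 2
        + incl d u 2 (p * s) * frameIdem d u 3 k 2 * braid d u 3 1 * incl d u 2 s := by
    have incl_s : incl d u 2 s = 1 + braid d u 3 0 := by
      rw [hs, map_add, map_one, incl_braid (by omega)]
    rw [tripleIdem_mul_braidSum_eq, map_mul, incl_s, hp, map_mul, incl_frameIdem k (by omega),
      incl_frameIdem k (by omega)]
  rw [expand, map_add, h.map_incl_mul_frameIdem hx, h.map_incl_mul_frameIdem_mul_braid_mul_incl,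
    pair_mul_idem, pair_mul_sq, map_smul, map_pair, smul_eq_mul]
  ring

theorem passesToFTL_iff (h : IsJuyumayaTrace d u z x tr) (hx : x 0 = 1) (hu : u ≠ 0)
    (hn : 3 ≤ n) :
    PassesToFTL (tr n) ↔ ∀ k, frameWeight x k *
      (frameWeight x k + z) * (frameWeight x k + (u + 1) * z) = 0 := by
  simp only [← h.map_tripleIdem_mul_braidSum hx]
  rw [passesToFTL_iff_map_mul_ftlGen (h.comm n)]
  constructor
  · intro hτ k
    rw [← h.map_tripleIdem_mul_braidSum_of_le k hn, ← frameIdem_mul_ftlGen]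
    exact hτ 0 (by omega) _
  · intro hvanish i hi b
    exact h.map_mul_ftlGen hx hu hvanish hi b

end IsJuyumayaTrace

end Quotient

section Parameters

variable {d : ℕ} [NeZero d] {u z : ℂ} {x : ZMod d → ℂ}

theorem mem_ftSupport {k : ZMod d} : k ∈ ftSupport x ↔ frameWeight x k ≠ 0 := by
  simp [ftSupport, dft_eq_mul_frameWeight, NeZero.ne]

theorem mem_ftD₁ {k : ZMod d} : k ∈ ftD₁ z x ↔ frameWeight x k ≠ 0 ∧ frameWeight x k = -z := by
  rw [ftD₁, Finset.mem_filter, mem_ftSupport, dft_eq_mul_frameWeight, neg_mul_comm,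
    mul_right_inj' (NeZero.ne _)]

theorem mem_ftD₂ {k : ZMod d} :
    k ∈ ftD₂ u z x ↔ frameWeight x k ≠ 0 ∧ frameWeight x k = -((u + 1) * z) := by
  rw [ftD₂, Finset.mem_filter, mem_ftSupport, dft_eq_mul_frameWeight,
    show -(d : ℂ) * z * (u + 1) = d * (-((u + 1) * z)) by ring, mul_right_inj' (NeZero.ne _)]

theorem ne_zero_of_frameWeight (hx : x 0 = 1)
    (hw : ∀ k, frameWeight x k * (frameWeight x k + z) * (frameWeight x k + (u + 1) * z) = 0) :
    z ≠ 0 := by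
  rintro rfl
  have frameWeight_eq_zero (k : ZMod d) : frameWeight x k = 0 := by simpa using hw k
  have sum_eq := sum_frameWeight x
  simp [frameWeight_eq_zero, hx] at sum_eq

theorem disjoint_ftD (hu : u ≠ 0) (hz : z ≠ 0) : Disjoint (ftD₁ z x) (ftD₂ u z x) := by
  rw [Finset.disjoint_left]
  intro k h₁ h₂
  have mul_eq_zero : u * z = 0 := by
    linear_combination (mem_ftD₁.mp h₁).2.symm.trans (mem_ftD₂.mp h₂).2
  exact mul_ne_zero hu hz mul_eq_zero

theorem union_ftD
    (hw : ∀ k, frameWeight x k * (frameWeight x k + z) * (frameWeight x k + (u + 1) * z) = 0) :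
    ftD₁ z x ∪ ftD₂ u z x = ftSupport x := by
  ext k
  rw [Finset.mem_union, mem_ftD₁, mem_ftD₂, mem_ftSupport, ← and_or_left, and_iff_left_iff_imp]
  intro hk
  have roots := hw k
  simp only [mul_eq_zero, hk, false_or] at roots
  exact roots.imp eq_neg_of_add_eq_zero_left eq_neg_of_add_eq_zero_left

open Classical in
theorem frameWeight_eq_ite (hx : x 0 = 1) (hu : u ≠ 0)
    (hw : ∀ k, frameWeight x k * (frameWeight x k + z) * (frameWeight x k + (u + 1) * z) = 0)
    (k : ZMod d) :
    frameWeight x k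
      = -z * ((if k ∈ ftD₁ z x then 1 else 0) + (u + 1) * (if k ∈ ftD₂ u z x then 1 else 0)) := by
  by_cases h₁ : k ∈ ftD₁ z x
  · have h₂ := Finset.disjoint_left.mp (disjoint_ftD hu (ne_zero_of_frameWeight hx hw)) h₁
    simp [h₁, h₂, (mem_ftD₁.mp h₁).2]
  by_cases h₂ : k ∈ ftD₂ u z x
  · rw [if_neg h₁, if_pos h₂, (mem_ftD₂.mp h₂).2]
    ring
  · have notMem_support : k ∉ ftSupport x := by simp [← union_ftD hw, h₁, h₂]
    simp [h₁, h₂, not_not.mp (mt mem_ftSupport.mpr notMem_support)]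

open Classical in
theorem frameWeight_mul_mul_eq_zero_of_eq_ite {k : ZMod d}
    (hk : frameWeight x k
      = -z * ((if k ∈ ftD₁ z x then 1 else 0) + (u + 1) * (if k ∈ ftD₂ u z x then 1 else 0))) :
    frameWeight x k * (frameWeight x k + z) * (frameWeight x k + (u + 1) * z) = 0 := by
  by_cases h₁ : k ∈ ftD₁ z x
  · simp [(mem_ftD₁.mp h₁).2]
  by_cases h₂ : k ∈ ftD₂ u z x
  · simp [(mem_ftD₂.mp h₂).2]
  · simp [hk, h₁, h₂]

open Classical in
theorem sum_stdAddChar_mul_ite (m : ZMod d) :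
    ∑ k : ZMod d, (ZMod.stdAddChar (k * m) : ℂ) *
        (-z * ((if k ∈ ftD₁ z x then 1 else 0) + (u + 1) * (if k ∈ ftD₂ u z x then 1 else 0)))
      = -z * (∑ k ∈ ftD₁ z x, ZMod.stdAddChar (k * m) +
          (u + 1) * ∑ k ∈ ftD₂ u z x, ZMod.stdAddChar (k * m)) := by
  have sum_eq (D : Finset (ZMod d)) : ∑ k ∈ D, (ZMod.stdAddChar (k * m) : ℂ)
      = ∑ k : ZMod d, if k ∈ D then (ZMod.stdAddChar (k * m) : ℂ) else 0 := by
    simp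
  rw [sum_eq, sum_eq, Finset.mul_sum, ← Finset.sum_add_distrib, Finset.mul_sum]
  refine Finset.sum_congr rfl fun k _ => ?_
  split_ifs <;> ring

theorem forall_frameWeight_mul_mul_eq_zero_iff (hx : x 0 = 1) (hu : u ≠ 0) :
    (∀ k, frameWeight x k * (frameWeight x k + z) * (frameWeight x k + (u + 1) * z) = 0) ↔
      ∀ m : ZMod d, x m = -z * (∑ k ∈ ftD₁ z x, ZMod.stdAddChar (k * m) +
        (u + 1) * ∑ k ∈ ftD₂ u z x, ZMod.stdAddChar (k * m)) := by
  classical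
  simp only [← sum_stdAddChar_mul_ite, ← frameWeight_eq_iff]
  exact ⟨frameWeight_eq_ite hx hu, fun hw k => frameWeight_mul_mul_eq_zero_of_eq_ite (hw k)⟩

theorem eq_neg_one_div_card_of_sum (hx : x 0 = 1)
    (hsum : ∀ m : ZMod d, x m = -z * (∑ k ∈ ftD₁ z x, ZMod.stdAddChar (k * m) +
      (u + 1) * ∑ k ∈ ftD₂ u z x, ZMod.stdAddChar (k * m))) :
    ((ftD₁ z x).card : ℂ) + (u + 1) * ((ftD₂ u z x).card : ℂ) ≠ 0 ∧
      z = -1 / (((ftD₁ z x).card : ℂ) + (u + 1) * ((ftD₂ u z x).card : ℂ)) := by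
  have at_zero : 1 = -z * (((ftD₁ z x).card : ℂ) + (u + 1) * ((ftD₂ u z x).card : ℂ)) := by
    simpa [hx] using hsum 0
  have card_ne_zero := right_ne_zero_of_mul (at_zero ▸ one_ne_zero)
  refine ⟨card_ne_zero, ?_⟩
  rw [eq_div_iff card_ne_zero]
  linear_combination at_zero

end Parameters

theorem mainTheorem1 (d : ℕ) [NeZero d] (u : ℂ) (hu : u ≠ 0) (z : ℂ)
    (x : ZMod d → ℂ) (hx : x 0 = 1) :
    (∃! tr : ∀ n : ℕ, YH d u n →ₗ[ℂ] ℂ, IsJuyumayaTrace d u z x tr) ∧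
    ∀ tr : ∀ n : ℕ, YH d u n →ₗ[ℂ] ℂ, IsJuyumayaTrace d u z x tr → ∀ n : ℕ, 3 ≤ n →
      (PassesToFTL (tr n) ↔
        (∀ m : ZMod d, x m = -z * (∑ k ∈ ftD₁ z x, ZMod.stdAddChar (k * m) +
            (u + 1) * ∑ k ∈ ftD₂ u z x, ZMod.stdAddChar (k * m))) ∧
        (((ftD₁ z x).card : ℂ) + (u + 1) * ((ftD₂ u z x).card : ℂ) ≠ 0 ∧
          z = -1 / (((ftD₁ z x).card : ℂ) + (u + 1) * ((ftD₂ u z x).card : ℂ)))) ∧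
      (PassesToFTL (tr n) →
        Disjoint (ftD₁ z x) (ftD₂ u z x) ∧
        ftD₁ z x ∪ ftD₂ u z x = ftSupport x) := by
  refine ⟨existsUnique_isJuyumayaTrace u z hx, fun tr h n hn => ⟨?_, fun hp => ?_⟩⟩
  · rw [h.passesToFTL_iff hx hu hn, forall_frameWeight_mul_mul_eq_zero_iff hx hu]
    exact (and_iff_left_of_imp (eq_neg_one_div_card_of_sum hx)).symm
  · have hw := (h.passesToFTL_iff hx hu hn).mp hp
    exact ⟨disjoint_ftD hu (ne_zero_of_frameWeight hx hw), union_ftD hw⟩
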